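/- Let $G$ be a connected semisimple real Lie group with Lie algebra $\mathfrak g$ and Killing form $B$. Let $H\subseteq G$ be a closed connected subgroup, with Lie algebra $\mathfrak h$, that is reductive in $G$, i.e. the adjoint action of $\mathfrak h$ on $\mathfrak g$ is semisimple. Let $\Theta:G\to G$ be a global Cartan involution, i.e. an involutive Lie group automorphism whose differential $\theta$ at the identity is an involution of the Lie algebra $\mathfrak g$ such that $(X,Y)\mapsto -B(X,\theta Y)$ is symmetric and positive definite; assume $\Theta(H)\subseteq H$. Let $\mathfrak k$ be the Lie algebra of the fixed subgroup $K=\{g\in G:\Theta(g)=g\}$, let $\mathfrak z_{\mathfrak g}$ be the Lie algebra of the centraliser $Z_G(H)$, and put $\mathfrak p=\mathfrak k^{\perp}\cap\mathfrak z_{\mathfrak g}^{\perp}$, the orthogonals being taken in $\mathfrak g$ with respect to $B$. Let $\rho:G\to GL(V)$ be a (smooth) linear representation on a finite-dimensional real vector space $V$ with $\dim V>0$, equipped with a Euclidean structure, with norm $\|\cdot\|$, such that $d\rho(\theta X)=-d\rho(X)^{*}$ for all $X\in\mathfrak g$, where $d\rho:\mathfrak g\to\mathfrak{gl}(V)$ is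 the differential of $\rho$ and ${}^{*}$ is the Euclidean adjunction. Let $C(\mathrm{Ad}_\rho)$ be the real vector space of functions on $H$ spanned by the matrix coefficients $h\mapsto\phi(\rho(h)g\rho(h)^{-1})$ with $g\in\mathfrak{gl}(V)$ and $\phi\in\mathfrak{gl}(V)^{\vee}$, on which $H$ acts by right translations. Let $\Omega\subseteq H$ be a nonempty subset such that $(*)$ every $f\in C(\mathrm{Ad}_\rho)$ vanishing on $\Omega$ vanishes on $H$. Then there is exactly one $H$-equivariant linear projector $\pi_{\mathbf R}$ of $C(\mathrm{Ad}_\rho)$ onto the constant functions (constant functions being identified with real numbers), and, setting $$c=\sup\Bigl\{\pi_{\mathbf R}(f)\;:\;f\in C(\mathrm{Ad}_\rho),\ \sup_{\omega\in\Omega}|f(\omega)|\le 1\Bigr\}\in[-\infty,+\infty],$$ we have $1\le c<\infty$ and $$\forall p\in\exp(\mathfrak p),\ \forall v\in V,\qquad \sup_{\omega\in\Omega}\bigl\|\rho(\omega^{-1}p\,\omega)v\bigr\|\ \ge\ \|v\|/c ,$$ where the supremum may be $+\infty$. -/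

import Mathlib

open scoped Manifold ContDiff

noncomputable section

namespace CartanRep

section LieGroup

variable {n : ℕ} {G : Type*} [TopologicalSpace G] [ChartedSpace (EuclideanSpace ℝ (Fin n)) G]
  [Group G]

/-- `γ` is the curve `t ↦ exp (t X)`: the integral curve, starting at the identity, of the
left-invariant vector field with value `X` at the identity. -/
def IsExpCurve (X : GroupLieAlgebra (𝓡 n) G) (γ : ℝ → G) : Prop :=
  γ 0 = 1 ∧ IsMIntegralCurve (I := 𝓡 n) γ (mulInvariantVectorField X)

/-- The image `exp S` under the exponential map of `G` of a subset `S` of the Lie algebra. -/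
def expImage (S : Set (GroupLieAlgebra (𝓡 n) G)) : Set G :=
  {p | ∃ X ∈ S, ∃ γ : ℝ → G, IsExpCurve X γ ∧ γ 1 = p}

variable (n) in
/-- The Lie algebra of a closed subgroup `S` of `G`, as a subset of the Lie algebra of `G`: all `X`
such that `exp (t X)` belongs to `S` for every real `t`. -/
def lieAlgebraOf (S : Subgroup G) :
    Set (GroupLieAlgebra (𝓡 n) G) :=
  {X | ∃ γ : ℝ → G, IsExpCurve X γ ∧ ∀ t, γ t ∈ S}

variable (n) in
/-- The differential at the identity of an endomorphism of `G`. (The target of `mfderiv` is the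
tangent space at `Θ 1`, and `Θ 1 = 1`.) -/
def differential (Θ : G →* G) :
    GroupLieAlgebra (𝓡 n) G →L[ℝ] GroupLieAlgebra (𝓡 n) G :=
  mfderiv (𝓡 n) (𝓡 n) Θ 1

/-- The subgroup of fixed points of an endomorphism of `G`. -/
def fixedSubgroup {G : Type*} [Group G] (Θ : G →* G) : Subgroup G :=
  Θ.eqLocus (MonoidHom.id G)

variable [LieGroup (𝓡 n) ∞ G]

instance lieGroupMinSmoothness : LieGroup (𝓡 n) (minSmoothness ℝ 3) G :=
  LieGroup.of_le (m := minSmoothness ℝ 3) (n := ∞) (by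
    simp only [minSmoothness_of_isRCLikeNormedField]
    exact ENat.LEInfty.out)

end LieGroup

/-- A Cartan involution of a real Lie algebra, with `B` the Killing form: an involutive
automorphism `θ` for which `(X, Y) ↦ -B (X, θ Y)` is symmetric and positive definite. -/
structure IsCartanInvolution {𝔤 : Type*} [LieRing 𝔤] [LieAlgebra ℝ 𝔤] (θ : 𝔤 → 𝔤) : Prop where
  map_add : ∀ X Y, θ (X + Y) = θ X + θ Y
  map_smul : ∀ (a : ℝ) X, θ (a • X) = a • θ X
  map_lie : ∀ X Y, θ ⁅X, Y⁆ = ⁅θ X, θ Y⁆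
  involutive : ∀ X, θ (θ X) = X
  symm : ∀ X Y, -killingForm ℝ 𝔤 X (θ Y) = -killingForm ℝ 𝔤 Y (θ X)
  pos : ∀ X, X ≠ 0 → 0 < -killingForm ℝ 𝔤 X (θ X)

section LieGroup

variable {n : ℕ} {G : Type*} [TopologicalSpace G] [ChartedSpace (EuclideanSpace ℝ (Fin n)) G]
  [Group G] [LieGroup (𝓡 n) ∞ G]

variable (n) in
/-- A global Cartan involution of `G`: an involutive Lie group automorphism whose differential at
the identity is a Cartan involution of the Lie algebra. -/
structure IsGlobalCartanInvolution (Θ : G →* G) : Prop where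
  smooth : ContMDiff (𝓡 n) (𝓡 n) ∞ Θ
  involutive : ∀ g, Θ (Θ g) = g
  cartan : IsCartanInvolution (𝔤 := GroupLieAlgebra (𝓡 n) G) (differential n Θ)

variable (n) in
/-- `H` is a connected reductive subgroup in `G`: it is closed and connected, and the adjoint action
of its Lie algebra `𝔥` on `𝔤` is semisimple, that is, every `𝔥`-stable subspace of `𝔤` has an
`𝔥`-stable complement. -/
structure IsReductiveIn (H : Subgroup G) : Prop where
  closed : IsClosed (H : Set G)
  connected : IsConnected (H : Set G)
  semisimple : ∀ W : Submodule ℝ (GroupLieAlgebra (𝓡 n) G),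
    (∀ X ∈ lieAlgebraOf n H, ∀ Y ∈ W, ⁅X, Y⁆ ∈ W) →
    ∃ W' : Submodule ℝ (GroupLieAlgebra (𝓡 n) G), IsCompl W W' ∧
      ∀ X ∈ lieAlgebraOf n H, ∀ Y ∈ W', ⁅X, Y⁆ ∈ W'

/-- The orthogonal of a subset of the Lie algebra of `G` for the Killing form. -/
def killingOrthogonal (S : Set (GroupLieAlgebra (𝓡 n) G)) : Set (GroupLieAlgebra (𝓡 n) G) :=
  {X | ∀ Y ∈ S, killingForm ℝ (GroupLieAlgebra (𝓡 n) G) X Y = 0}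

variable (n) in
/-- The subspace `𝔭 = 𝔨^⊥ ∩ 𝔷^⊥`, where `𝔨` is the Lie algebra of the fixed points of `Θ` and `𝔷` is
the Lie algebra of the centraliser of `H` in `G`. -/
def pSpace (Θ : G →* G) (H : Subgroup G) : Set (GroupLieAlgebra (𝓡 n) G) :=
  killingOrthogonal (lieAlgebraOf n (fixedSubgroup Θ)) ∩
    killingOrthogonal (lieAlgebraOf n (Subgroup.centralizer (H : Set G)))

end LieGroup

section Representation

variable {G : Type*} [Group G] {V : Type*} [NormedAddCommGroup V]

/-- The tangent representation `dρ : 𝔤 → 𝔤𝔩(V)` of `ρ`. -/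
def tangentRep (n : ℕ) {G : Type*} [TopologicalSpace G]
    [ChartedSpace (EuclideanSpace ℝ (Fin n)) G] [Group G]
    {V : Type*} [NormedAddCommGroup V] [NormedSpace ℝ V] (ρ : G →* (V →L[ℝ] V)) :
    GroupLieAlgebra (𝓡 n) G →L[ℝ] (V →L[ℝ] V) :=
  mfderiv (𝓡 n) 𝓘(ℝ, V →L[ℝ] V) ρ 1

/-- The Euclidean structure of `V` is adapted to `Θ` and `ρ`: the opposite of the Euclidean
adjunction on `𝔤𝔩(V)` sends `dρ X` to `dρ (θ X)`, for every `X` in the Lie algebra, `θ` being the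
differential of `Θ`. -/
def IsAdapted (n : ℕ) {G : Type*} [TopologicalSpace G]
    [ChartedSpace (EuclideanSpace ℝ (Fin n)) G] [Group G]
    {V : Type*} [NormedAddCommGroup V] [InnerProductSpace ℝ V]
    (Θ : G →* G) (ρ : G →* (V →L[ℝ] V)) : Prop :=
  ∀ (X : GroupLieAlgebra (𝓡 n) G) (v w : V),
    inner ℝ (tangentRep n ρ (differential n Θ X) v) w = -inner ℝ v (tangentRep n ρ X w)

variable [NormedSpace ℝ V]

/-- The matrix coefficient `h ↦ φ (ρ(h) g ρ(h)⁻¹)` on `H` of the representation of `G` on `𝔤𝔩(V)` by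
conjugation. -/
def matrixCoeff (ρ : G →* (V →L[ℝ] V)) (H : Subgroup G)
    (φ : Module.Dual ℝ (V →L[ℝ] V)) (g : V →L[ℝ] V) : H → ℝ :=
  fun h => φ (ρ (h : G) * g * ρ (h : G)⁻¹)

/-- The space `C(Ad_ρ)` of functions on `H` spanned by the matrix coefficients. -/
def coeffSpace (ρ : G →* (V →L[ℝ] V)) (H : Subgroup G) : Submodule ℝ (H → ℝ) :=
  Submodule.span ℝ {f | ∃ φ g, f = matrixCoeff ρ H φ g}

/-- `C(Ad_ρ)` is stable under right translations by elements of `H`. -/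
theorem rightTranslate_mem (ρ : G →* (V →L[ℝ] V)) (H : Subgroup G) (h' : H) {f : H → ℝ}
    (hf : f ∈ coeffSpace ρ H) : (fun h => f (h * h')) ∈ coeffSpace ρ H := by
  have key : coeffSpace ρ H ≤
      (coeffSpace ρ H).comap (LinearMap.funLeft ℝ ℝ (fun h : H => h * h')) := by
    refine Submodule.span_le.2 ?_
    rintro _ ⟨φ, g, rfl⟩
    refine Submodule.subset_span ⟨φ, ρ (h' : G) * g * ρ (h' : G)⁻¹, ?_⟩
    funext h
    simp [LinearMap.funLeft_apply, matrixCoeff, mul_assoc]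
  exact key hf

/-- The action of `h' ∈ H` on `C(Ad_ρ)` by right translation. -/
def rightTranslate (ρ : G →* (V →L[ℝ] V)) (H : Subgroup G) (h' : H) (f : coeffSpace ρ H) :
    coeffSpace ρ H :=
  ⟨fun h => (f : H → ℝ) (h * h'), rightTranslate_mem ρ H h' f.2⟩

/-- `π` is the `H`-equivariant projector of `C(Ad_ρ)` onto the constant functions, a constant
function being identified with its value. -/
structure IsConstProjector (ρ : G →* (V →L[ℝ] V)) (H : Subgroup G)
    (π : coeffSpace ρ H →ₗ[ℝ] ℝ) : Prop where
  equivariant : ∀ (h' : H) (f : coeffSpace ρ H), π (rightTranslate ρ H h' f) = π f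
  apply_const : ∀ (f : coeffSpace ρ H) (a : ℝ), (∀ h, (f : H → ℝ) h = a) → π f = a

/-- The constant `c = sup {π f | f ∈ C(Ad_ρ), sup_Ω |f| ≤ 1}`, possibly infinite. -/
def cConst (ρ : G →* (V →L[ℝ] V)) (H : Subgroup G) (π : coeffSpace ρ H →ₗ[ℝ] ℝ)
    (Ω : Set H) : EReal :=
  ⨆ f ∈ {f : coeffSpace ρ H | ∀ x ∈ Ω, |(f : H → ℝ) x| ≤ 1}, ((π f : ℝ) : EReal)

end Representation

end CartanRep

end

/-!
Let `𝔤𝔩(V)` carry the Hilbert–Schmidt inner product `tr (x* y)`, and let `H` act on it by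
conjugation through `ρ`. The compatibility of the Euclidean structure with `Θ`, integrated over the
connected group `G`, says that `ρ(Θ g) = (ρ(g)*)⁻¹` (`IsAdapted.rep_mul_adjoint`). As `H` is stable
under `Θ`, the group `ρ(H)` is stable under adjunction, and so is its action on `𝔤𝔩(V)`
(`isSelfAdjointGroup_rep`, `conjAction_adjoint`).

For such an action the orthogonal projection `P` to the fixed vectors, here the commutant of `ρ(H)`,
is a finite linear combination of the operators of the action (`exists_mean`). The same combination
of evaluations is an invariant functional on `C(Ad_ρ)`; it is the only projector `π` onto the
constants, and it sends the coefficient of `φ` and `g` to `φ (P g)` (`exists_constProjector`). The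
constant `c` is finite because the hypothesis on `Ω` makes `π` a combination of evaluations at
points of `Ω` (`cConst_lt_top`).

Let `p = exp X` with `X ∈ 𝔭`. As `X` is orthogonal to `𝔨`, it is anti-invariant under the Cartan
involution, `Y = dρ(X)` is symmetric, and `ρ(p) = exp Y ≥ 1 + Y`
(`inner_add_inner_tangentRep_le`). As `X` is orthogonal to the Lie algebra of the centraliser of
`H`, the trace form makes `Y` orthogonal to the commutant of `ρ(H)`
(`opTrace_tangentRep_mul_eq_zero`). The coefficient `f(h) = ⟨v, ρ(h⁻¹ p h) v⟩` has
`π f = tr (ρ(p) Q)`, where `Q` is the projection `P` of the rank one operator `v ⊗ v`. The operator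
`Q` is positive, commutes with `ρ(H)` and has trace `‖v‖²`, whence
`π f ≥ tr Q + tr (Y Q) = ‖v‖²` (`norm_sq_le_opTrace_mean`). On the other hand
`|f| ≤ ‖v‖ sup_Ω ‖ρ(ω⁻¹ p ω) v‖` on `Ω`, so `π f` is at most `c ‖v‖` times that supremum
(`norm_div_cConst_le`).
-/

noncomputable section

namespace CartanRep

/-! ### Averaging over a self-adjoint group of operators -/

section Averaging

variable {E : Type*} [AddCommGroup E] [Module ℝ E] [FiniteDimensional ℝ E]

/-- Orthogonal projection for a positive definite symmetric form. -/
lemma exists_orthogonal_projection (β : E →ₗ[ℝ] E →ₗ[ℝ] ℝ) (hsymm : ∀ x y, β x y = β y x)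
    (hpos : ∀ x, x ≠ 0 → 0 < β x x) (W : Submodule ℝ E) (u : E) :
    ∃ w ∈ W, ∀ z ∈ W, β (u - w) z = 0 := by
  have hrefl : LinearMap.IsRefl β := fun x y h => by rw [hsymm, h]
  have hnd : (LinearMap.BilinForm.restrict β W).Nondegenerate := by
    have hsep : ∀ x : W, (∀ y : W, LinearMap.BilinForm.restrict β W x y = 0) → x = 0 := by
      intro x hx
      by_contra hne
      have := hpos x (by simpa using hne)
      exact this.ne' (hx x)
    refine ⟨hsep, fun y hy => hsep y fun x => ?_⟩
    exact (hsymm _ _).trans (hy x)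
  have hc := LinearMap.BilinForm.isCompl_orthogonal_of_restrict_nondegenerate hrefl hnd
  obtain ⟨w, hw, z, hz, rfl⟩ := Submodule.mem_sup.1
    (hc.sup_eq_top ▸ Submodule.mem_top : u ∈ W ⊔ LinearMap.BilinForm.orthogonal β W)
  refine ⟨w, hw, fun y hy => ?_⟩
  rw [add_sub_cancel_left, hsymm]
  exact hz y hy

variable {Γ : Type*} [Monoid Γ]

/-- For a family of operators stable under adjunction, the orthogonal projection of a vector to the
space of fixed vectors lies in the span of its orbit: the component of the projection orthogonal to
that span is again fixed, hence orthogonal to the projection itself. -/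
lemma exists_fixed_mem_span_orbit (β : E →ₗ[ℝ] E →ₗ[ℝ] ℝ) (hsymm : ∀ x y, β x y = β y x)
    (hpos : ∀ x, x ≠ 0 → 0 < β x x) (a : Γ →* Module.End ℝ E)
    (hadj : ∀ h, ∃ h', ∀ x y, β (a h x) y = β x (a h' y)) (u : E) :
    ∃ w ∈ Submodule.span ℝ (Set.range fun h => a h u), (∀ h, a h w = w) ∧
      ∀ z, (∀ h, a h z = z) → β (u - w) z = 0 := by
  let F : Submodule ℝ E := ⨅ h, LinearMap.ker (a h - 1)
  have hF : ∀ z, z ∈ F ↔ ∀ h, a h z = z := fun z => by simp [F, sub_eq_zero]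
  obtain ⟨w, hwF, hw⟩ := exists_orthogonal_projection β hsymm hpos F u
  set W := Submodule.span ℝ (Set.range fun h => a h u) with hW
  have huW : u ∈ W := Submodule.subset_span ⟨1, by simp⟩
  have hWa : ∀ h, ∀ x ∈ W, a h x ∈ W := by
    intro h x hx
    have : W ≤ W.comap (a h) := by
      refine Submodule.span_le.2 ?_
      rintro _ ⟨k, rfl⟩
      exact Submodule.subset_span ⟨h * k, by simp⟩
    exact this hx
  obtain ⟨w₁, hw₁, hw₂⟩ := exists_orthogonal_projection β hsymm hpos W w
  have hfix : w - w₁ ∈ F := by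
    rw [hF]
    intro h
    by_contra hne
    have hd : a h (w - w₁) - (w - w₁) ∈ W := by
      rw [map_sub, (hF w).1 hwF h]
      have : w - a h w₁ - (w - w₁) = w₁ - a h w₁ := by abel
      rw [this]
      exact W.sub_mem hw₁ (hWa h _ hw₁)
    have h0 : β (a h (w - w₁) - (w - w₁)) (a h (w - w₁) - (w - w₁)) = 0 := by
      obtain ⟨h', hh'⟩ := hadj h
      rw [LinearMap.map_sub₂, hh', hw₂ _ (hWa h' _ hd), hw₂ _ hd, sub_zero]
    exact (hpos _ (sub_ne_zero.2 hne)).ne' h0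
  have hzero : w - w₁ = 0 := by
    by_contra hne
    refine (hpos _ hne).ne' ?_
    have h1 := hw _ hfix
    have h2 := hw₂ u huW
    have h3 := hw₂ w₁ hw₁
    rw [LinearMap.map_sub₂, hsymm u, h2, hsymm w] at h1
    rw [map_sub, h3]
    linarith
  refine ⟨w, ?_, (hF w).1 hwF, fun z hz => hw z ((hF z).2 hz)⟩
  rw [sub_eq_zero.1 hzero]
  exact hw₁

/-- The orthogonal projection to the fixed vectors of a group of operators stable under
adjunction is a linear combination of the operators. -/
lemma exists_mean (β : E →ₗ[ℝ] E →ₗ[ℝ] ℝ) (hsymm : ∀ x y, β x y = β y x)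
    (hpos : ∀ x, x ≠ 0 → 0 < β x x) (a : Γ →* Module.End ℝ E)
    (hadj : ∀ h, ∃ h', ∀ x y, β (a h x) y = β x (a h' y)) :
    ∃ c : Γ →₀ ℝ, ∃ P : Module.End ℝ E, (∀ g, P g = c.sum fun h t => t • a h g) ∧
      (∀ h g, a h (P g) = P g) ∧ (∀ h g, P (a h g) = P g) ∧
      ∀ g z, (∀ h, a h z = z) → β (P g) z = β g z := by
  classical
  let e := Module.finBasis ℝ E
  let β' : Module.End ℝ E →ₗ[ℝ] Module.End ℝ E →ₗ[ℝ] ℝ :=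
    ∑ i, β.compl₁₂ (LinearMap.applyₗ (e i)) (LinearMap.applyₗ (e i))
  have hβ' : ∀ x y, β' x y = ∑ i, β (x (e i)) (y (e i)) := fun x y => by
    simp [β', LinearMap.sum_apply]
  let a' : Γ →* Module.End ℝ (Module.End ℝ E) :=
    ((Algebra.lmul ℝ (Module.End ℝ E)) : Module.End ℝ E →* _).comp a
  have ha' : ∀ h x, a' h x = a h * x := fun h x => rfl
  -- The group acts on `End E` by left multiplication. The orbit of the identity spans the linear
  -- combinations of the operators, so a fixed vector in this span is the operator `P` sought.
  obtain ⟨P, hP, hfix, horth⟩ := exists_fixed_mem_span_orbit β'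
    (fun x y => by simp only [hβ', hsymm (x _)])
    (fun x hx => by
      rw [hβ']
      have h0 : ∀ y, 0 ≤ β y y := fun y => by
        by_cases hy : y = 0
        · simp [hy]
        · exact (hpos y hy).le
      obtain ⟨i, hi⟩ : ∃ i, x (e i) ≠ 0 := by
        by_contra hcon
        push Not at hcon
        exact hx (e.ext fun i => by simp [hcon i])
      exact Finset.sum_pos' (fun i _ => h0 _) ⟨i, Finset.mem_univ _, hpos _ hi⟩)
    a' (fun h => by
      obtain ⟨h', hh'⟩ := hadj h
      exact ⟨h', fun x y => by simp [hβ', ha', hh']⟩) 1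
  have hproj : ∀ g z, (∀ h, a h z = z) → β (P g) z = β g z := by
    intro g z hz
    suffices h : (β.flip z).comp P = β.flip z from LinearMap.congr_fun h g
    refine e.ext fun i => ?_
    -- The fixed elements of `End E` include the rank one operators with image spanned by `z`.
    have := horth (LinearMap.toSpanSingleton ℝ E z ∘ₗ e.coord i) (fun h => by
      ext x; simp [ha', hz h])
    rw [hβ', Finset.sum_eq_single i] at this
    · simpa using (sub_eq_zero.1 (by simpa using this)).symm
    · intro j _ hji
      simp [hji]
    · simp
  have hfix' : ∀ h g, a h (P g) = P g := fun h g => LinearMap.congr_fun (hfix h) g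
  obtain ⟨c, hc⟩ := Finsupp.mem_span_range_iff_exists_finsupp.1 hP
  refine ⟨c, P, fun g => ?_, hfix', fun h g => ?_, hproj⟩
  · rw [← hc, Finsupp.sum, Finsupp.sum, LinearMap.sum_apply]
    exact Finset.sum_congr rfl fun h _ => by simp [ha']
  · by_contra hne
    refine (hpos _ (sub_ne_zero.2 hne)).ne' ?_
    have hz : ∀ k, a k (P (a h g) - P g) = P (a h g) - P g := fun k => by
      rw [map_sub, hfix', hfix']
    obtain ⟨h', hh'⟩ := hadj h
    rw [LinearMap.map_sub₂, hproj _ _ hz, hproj _ _ hz, hh', hz h', sub_self]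

end Averaging

/-! ### Self-adjoint groups of operators on a Euclidean space -/

section Euclidean

open InnerProductSpace

variable {V : Type*} [NormedAddCommGroup V] [InnerProductSpace ℝ V]

variable (V) in
/-- The trace on continuous endomorphisms. -/
def opTrace : (V →L[ℝ] V) →ₗ[ℝ] ℝ :=
  LinearMap.trace ℝ V ∘ₗ ContinuousLinearMap.coeLM ℝ

lemma opTrace_apply (x : V →L[ℝ] V) : opTrace V x = LinearMap.trace ℝ V (x : V →ₗ[ℝ] V) := rfl

lemma opTrace_mul_comm (x y : V →L[ℝ] V) : opTrace V (x * y) = opTrace V (y * x) :=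
  LinearMap.trace_mul_comm ℝ (x : Module.End ℝ V) (y : Module.End ℝ V)

lemma opTrace_eq_sum_inner {ι : Type*} [Fintype ι] (b : OrthonormalBasis ι ℝ V) (x : V →L[ℝ] V) :
    opTrace V x = ∑ i, inner ℝ (b i) (x (b i)) :=
  LinearMap.trace_eq_sum_inner _ b

variable {Γ : Type*} [Group Γ] (r : Γ →* (V →L[ℝ] V))

/-- The action of a group of operators on endomorphisms by conjugation. -/
def conjAction : Γ →* Module.End ℝ (V →L[ℝ] V) where
  toFun h := LinearMap.mulLeftRight ℝ (r h, r h⁻¹)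
  map_one' := by ext; simp
  map_mul' h k := by ext x; simp [mul_assoc]

lemma conjAction_apply (h : Γ) (x : V →L[ℝ] V) : conjAction r h x = r h * x * r h⁻¹ := by
  simp [conjAction]

lemma conjAction_eq_self_iff (h : Γ) (x : V →L[ℝ] V) :
    conjAction r h x = x ↔ r h * x = x * r h := by
  have h1 : r h⁻¹ * r h = 1 := by rw [← map_mul]; simp
  have h2 : r h * r h⁻¹ = 1 := by rw [← map_mul]; simp
  rw [conjAction_apply]
  constructor <;> intro hx
  · calc r h * x = r h * x * (r h⁻¹ * r h) := by rw [h1, mul_one]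
      _ = x * r h := by rw [← mul_assoc, hx]
  · rw [hx, mul_assoc, h2, mul_one]

/-- A group of operators is self-adjoint if the adjoint of each of its elements is one of its
elements. -/
def IsSelfAdjointGroup : Prop :=
  ∀ h, ∃ h', ∀ u w, inner ℝ (r h u) w = inner ℝ u (r h' w)

/-- The commutant of a self-adjoint group is stable under adjunction. -/
lemma adjoint_comm [CompleteSpace V] {r : Γ →* (V →L[ℝ] V)} (hr : IsSelfAdjointGroup r)
    (x : V →L[ℝ] V) (hx : ∀ h, r h * x = x * r h) (h : Γ) :
    r h * ContinuousLinearMap.adjoint x = ContinuousLinearMap.adjoint x * r h := by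
  obtain ⟨h', hh'⟩ := hr h
  ext u
  refine ext_inner_right ℝ fun w => ?_
  have := congr($(hx h') w)
  simp only [mul_apply_eq_comp] at this ⊢
  rw [hh', ContinuousLinearMap.adjoint_inner_left, ContinuousLinearMap.adjoint_inner_left, hh',
    this]

variable [FiniteDimensional ℝ V]

lemma opTrace_mul_rankOne (x : V →L[ℝ] V) (v w : V) :
    opTrace V (x * rankOne ℝ v w) = inner ℝ w (x v) := by
  rw [ContinuousLinearMap.mul_def, comp_rankOne, opTrace_apply, trace_rankOne]

lemma opTrace_adjoint [CompleteSpace V] (x : V →L[ℝ] V) :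
    opTrace V (ContinuousLinearMap.adjoint x) = opTrace V x := by
  simp only [opTrace_eq_sum_inner (stdOrthonormalBasis ℝ V)]
  exact Finset.sum_congr rfl fun i _ => by
    rw [ContinuousLinearMap.adjoint_inner_right, real_inner_comm]

/-- The Hilbert–Schmidt inner product `(x, y) ↦ tr (x* y)` on endomorphisms. -/
def hsForm : (V →L[ℝ] V) →ₗ[ℝ] (V →L[ℝ] V) →ₗ[ℝ] ℝ :=
  LinearMap.mk₂ ℝ (fun x y => ∑ i, inner ℝ (x (stdOrthonormalBasis ℝ V i))
      (y (stdOrthonormalBasis ℝ V i)))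
    (fun x x' y => by simp [inner_add_left, Finset.sum_add_distrib])
    (fun t x y => by simp [inner_smul_left, Finset.mul_sum])
    (fun x y y' => by simp [inner_add_right, Finset.sum_add_distrib])
    (fun t x y => by simp [inner_smul_right, Finset.mul_sum])

lemma hsForm_apply (x y : V →L[ℝ] V) :
    hsForm x y = ∑ i, inner ℝ (x (stdOrthonormalBasis ℝ V i)) (y (stdOrthonormalBasis ℝ V i)) :=
  rfl

lemma hsForm_eq_opTrace [CompleteSpace V] (x y : V →L[ℝ] V) :
    hsForm x y = opTrace V (ContinuousLinearMap.adjoint x * y) := by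
  rw [opTrace_eq_sum_inner (stdOrthonormalBasis ℝ V), hsForm_apply]
  exact Finset.sum_congr rfl fun i _ => by
    rw [mul_apply_eq_comp, ContinuousLinearMap.adjoint_inner_right]

lemma hsForm_symm (x y : V →L[ℝ] V) : hsForm x y = hsForm y x := by
  simp only [hsForm_apply, real_inner_comm]

lemma hsForm_pos (x : V →L[ℝ] V) (hx : x ≠ 0) : 0 < hsForm x x := by
  rw [hsForm_apply]
  obtain ⟨i, hi⟩ : ∃ i, x (stdOrthonormalBasis ℝ V i) ≠ 0 := by
    by_contra hcon
    push Not at hcon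
    refine hx (ContinuousLinearMap.coe_injective
      ((stdOrthonormalBasis ℝ V).toBasis.ext fun i => ?_))
    simpa using hcon i
  exact Finset.sum_pos' (fun i _ => real_inner_self_nonneg)
    ⟨i, Finset.mem_univ _, real_inner_self_pos.2 hi⟩

/-- The trace of the product of two positive semidefinite operators is nonnegative. -/
lemma opTrace_mul_nonneg (S Q : V →L[ℝ] V) (hS : ∀ u, 0 ≤ inner ℝ u (S u))
    (hQ : (Q : V →ₗ[ℝ] V).IsSymmetric) (hQ' : ∀ (t : ℝ) (w : V), w ≠ 0 → Q w = t • w → 0 ≤ t) :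
    0 ≤ opTrace V (S * Q) := by
  rw [opTrace_eq_sum_inner (hQ.eigenvectorBasis rfl)]
  refine Finset.sum_nonneg fun i _ => ?_
  have he : Q (hQ.eigenvectorBasis rfl i) =
      hQ.eigenvalues rfl i • hQ.eigenvectorBasis rfl i := by
    exact hQ.apply_eigenvectorBasis rfl i
  rw [mul_apply_eq_comp, he, map_smul, inner_smul_right]
  exact mul_nonneg (hQ' _ _ ((hQ.eigenvectorBasis rfl).orthonormal.ne_zero i) he) (hS _)

/-- The orthogonal projection to a stable subspace commutes with a self-adjoint group. -/
lemma starProjection_comm {r : Γ →* (V →L[ℝ] V)} (hr : IsSelfAdjointGroup r) (U : Submodule ℝ V)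
    (hU : ∀ h, ∀ x ∈ U, r h x ∈ U) (h : Γ) :
    r h * U.starProjection = U.starProjection * r h := by
  ext x
  refine (Submodule.eq_starProjection_of_mem_of_inner_eq_zero
    (hU h _ (U.starProjection_apply_mem x)) fun w hw => ?_).symm
  obtain ⟨h', hh'⟩ := hr h
  change inner ℝ (r h x - r h (U.starProjection x)) w = 0
  rw [← map_sub, hh']
  exact Submodule.starProjection_inner_eq_zero _ _ (hU h' w hw)

/-- If `Q` commutes with a self-adjoint group and represents, through the trace, a vector state on
the commutant of that group, then the eigenvalues of `Q` are nonnegative: evaluate the state at the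
orthogonal projection to an eigenspace. -/
lemma eigenvalue_nonneg_of_vector_state {r : Γ →* (V →L[ℝ] V)} (hr : IsSelfAdjointGroup r)
    (Q : V →L[ℝ] V) (hQ : ∀ h, r h * Q = Q * r h) (v : V)
    (hstate : ∀ b : V →L[ℝ] V, (∀ h, r h * b = b * r h) →
      opTrace V (b * Q) = inner ℝ v (b v)) (t : ℝ) (w : V) (hw : w ≠ 0) (hQw : Q w = t • w) :
    0 ≤ t := by
  let U : Submodule ℝ V := LinearMap.ker ((Q : V →ₗ[ℝ] V) - t • 1)
  have hUmem : ∀ x, x ∈ U ↔ Q x = t • x := fun x => by simp [U, sub_eq_zero]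
  have hcomm := starProjection_comm hr U fun h x hx => by
    rw [hUmem] at hx ⊢
    have := congr($(hQ h) x)
    simp only [mul_apply_eq_comp] at this
    rw [← this, hx, map_smul]
  have hE : Q * U.starProjection = t • U.starProjection := by
    ext x
    exact (hUmem _).1 (U.starProjection_apply_mem x)
  have hsq : ∀ x, inner ℝ x (U.starProjection x) = ‖U.starProjection x‖ ^ 2 := fun x => by
    rw [← real_inner_self_eq_norm_sq, Submodule.inner_starProjection_left_eq_right,
      Submodule.starProjection_eq_self_iff.2 (U.starProjection_apply_mem x)]
  have h1 := hstate _ hcomm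
  rw [opTrace_mul_comm, hE, map_smul, hsq, smul_eq_mul,
    opTrace_eq_sum_inner (stdOrthonormalBasis ℝ V)] at h1
  simp only [hsq] at h1
  have hpos : 0 < ∑ i, ‖U.starProjection (stdOrthonormalBasis ℝ V i)‖ ^ 2 := by
    refine (Finset.sum_nonneg fun i _ => sq_nonneg _).lt_of_ne' fun h0 => hw ?_
    rw [Finset.sum_eq_zero_iff_of_nonneg fun i _ => sq_nonneg _] at h0
    have hz : U.starProjection = 0 := ContinuousLinearMap.coe_injective
      ((stdOrthonormalBasis ℝ V).toBasis.ext fun i => by simpa using h0 i (Finset.mem_univ i))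
    rw [← Submodule.starProjection_eq_self_iff.2 ((hUmem w).2 hQw), hz]
    rfl
  by_contra hneg
  have := mul_neg_of_neg_of_pos (not_le.1 hneg) hpos
  linarith [sq_nonneg ‖U.starProjection v‖]

/-- Conjugation by a self-adjoint group is self-adjoint for the Hilbert–Schmidt inner product. -/
lemma conjAction_adjoint {r : Γ →* (V →L[ℝ] V)} (hr : IsSelfAdjointGroup r) (h : Γ) :
    ∃ h', ∀ x y, hsForm (conjAction r h x) y = hsForm x (conjAction r h' y) := by
  have := FiniteDimensional.complete ℝ V
  obtain ⟨h', hh'⟩ := hr h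
  have h1 : ContinuousLinearMap.adjoint (r h) = r h' := by
    ext w
    refine ext_inner_left ℝ fun u => ?_
    rw [ContinuousLinearMap.adjoint_inner_right, hh']
  have h2 : ContinuousLinearMap.adjoint (r h⁻¹) = r h'⁻¹ := by
    have h3 : ContinuousLinearMap.adjoint (r h⁻¹) * r h' = 1 := by
      rw [← h1, ← ContinuousLinearMap.star_eq_adjoint, ← ContinuousLinearMap.star_eq_adjoint,
        ← star_mul, ← map_mul]
      simp
    calc ContinuousLinearMap.adjoint (r h⁻¹)
        = ContinuousLinearMap.adjoint (r h⁻¹) * (r h' * r h'⁻¹) := by rw [← map_mul]; simp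
      _ = r h'⁻¹ := by rw [← mul_assoc, h3, one_mul]
  refine ⟨h', fun x y => ?_⟩
  rw [hsForm_eq_opTrace, hsForm_eq_opTrace, conjAction_apply, conjAction_apply,
    ← ContinuousLinearMap.star_eq_adjoint, star_mul, star_mul,
    ContinuousLinearMap.star_eq_adjoint, ContinuousLinearMap.star_eq_adjoint,
    ContinuousLinearMap.star_eq_adjoint, h1, h2, mul_assoc, opTrace_mul_comm]
  simp only [mul_assoc]

/-- The mean of conjugation by a self-adjoint group: a linear combination `P` of the operators
`x ↦ r(h) x r(h)⁻¹` that projects to the commutant, orthogonally for the Hilbert–Schmidt inner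
product. -/
lemma exists_conj_mean {r : Γ →* (V →L[ℝ] V)} (hr : IsSelfAdjointGroup r) :
    ∃ c : Γ →₀ ℝ, ∃ P : Module.End ℝ (V →L[ℝ] V),
      (∀ g, P g = c.sum fun h t => t • conjAction r h g) ∧
      (∀ h g, conjAction r h (P g) = P g) ∧ (∀ h g, P (conjAction r h g) = P g) ∧
      ∀ g z, (∀ h, conjAction r h z = z) → hsForm (P g) z = hsForm g z :=
  exists_mean hsForm hsForm_symm hsForm_pos (conjAction r) (conjAction_adjoint hr)

/-- If `T ≥ 1 + Y` as quadratic forms and `Y` is orthogonal to the commutant of a self-adjoint group,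
then the mean over the group of the coefficient `h ↦ ⟨v, r(h)⁻¹ T r(h) v⟩` is at least `‖v‖²`. -/
lemma norm_sq_le_opTrace_mean {r : Γ →* (V →L[ℝ] V)} (hr : IsSelfAdjointGroup r)
    (P : Module.End ℝ (V →L[ℝ] V)) (hfix : ∀ h g, conjAction r h (P g) = P g)
    (hproj : ∀ g z, (∀ h, conjAction r h z = z) → hsForm (P g) z = hsForm g z)
    (T Y : V →L[ℝ] V) (hT : ∀ u, inner ℝ u u + inner ℝ u (Y u) ≤ inner ℝ u (T u))
    (hY : ∀ b : V →L[ℝ] V, (∀ h, r h * b = b * r h) → opTrace V (Y * b) = 0) (v : V) :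
    ‖v‖ ^ 2 ≤ opTrace V (T * P (rankOne ℝ v v)) := by
  have := FiniteDimensional.complete ℝ V
  set Q := P (rankOne ℝ v v) with hQdef
  have hQ : ∀ h, r h * Q = Q * r h := fun h => (conjAction_eq_self_iff r h Q).1 (hfix h _)
  have hstate : ∀ b : V →L[ℝ] V, (∀ h, r h * b = b * r h) →
      opTrace V (b * Q) = inner ℝ v (b v) := by
    intro b hb
    have := hproj (rankOne ℝ v v) (ContinuousLinearMap.adjoint b) fun h =>
      (conjAction_eq_self_iff r h _).2 (adjoint_comm hr b hb h)
    rw [hsForm_symm, hsForm_symm _ (ContinuousLinearMap.adjoint b), hsForm_eq_opTrace,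
      hsForm_eq_opTrace, ContinuousLinearMap.adjoint_adjoint, opTrace_mul_rankOne] at this
    exact this
  have hQsymm : ContinuousLinearMap.adjoint Q = Q := by
    -- `Q* - Q` lies in the commutant and is orthogonal to it.
    by_contra hne
    refine (hsForm_pos _ (sub_ne_zero.2 hne)).ne' ?_
    have hQ' := adjoint_comm hr Q hQ
    have hd : ∀ h, r h * (ContinuousLinearMap.adjoint Q - Q) =
        (ContinuousLinearMap.adjoint Q - Q) * r h := fun h => by
      rw [mul_sub, sub_mul, hQ, hQ']
    have hd' := adjoint_comm hr _ hd
    rw [hsForm_eq_opTrace, mul_sub, map_sub, hstate _ hd', ← opTrace_adjoint,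
      ← ContinuousLinearMap.star_eq_adjoint, ← ContinuousLinearMap.star_eq_adjoint, star_mul,
      ← ContinuousLinearMap.star_eq_adjoint, star_star, star_star, opTrace_mul_comm]
    rw [← ContinuousLinearMap.star_eq_adjoint] at hd
    rw [hstate _ hd, ContinuousLinearMap.star_eq_adjoint,
      ContinuousLinearMap.star_eq_adjoint (ContinuousLinearMap.adjoint Q - Q),
      ContinuousLinearMap.adjoint_inner_right, real_inner_comm, sub_self]
  have hsymm : (Q : V →ₗ[ℝ] V).IsSymmetric := fun x y => by
    have := ContinuousLinearMap.adjoint_inner_left Q y x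
    rwa [hQsymm] at this
  have hnonneg := opTrace_mul_nonneg (T - 1 - Y) Q
    (fun u => by
      have := hT u
      simp only [sub_apply, inner_sub_right, one_apply_eq_self]
      linarith) hsymm (eigenvalue_nonneg_of_vector_state hr Q hQ v hstate)
  have h1 := hstate 1 fun h => by rw [mul_one, one_mul]
  rw [one_apply_eq_self, real_inner_self_eq_norm_sq] at h1
  rw [sub_mul, sub_mul, map_sub, map_sub, h1, hY Q hQ] at hnonneg
  linarith

end Euclidean

/-! ### The space of coefficients and its invariant functional -/

section Coefficients

open InnerProductSpace

variable {G : Type*} [Group G] {V : Type*} [NormedAddCommGroup V]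

section

variable [InnerProductSpace ℝ V] (ρ : G →* (V →L[ℝ] V)) (H : Subgroup G)

lemma matrixCoeff_apply (φ : Module.Dual ℝ (V →L[ℝ] V)) (g : V →L[ℝ] V) (h : H) :
    matrixCoeff ρ H φ g h = φ (conjAction (ρ.comp H.subtype) h g) := by
  rw [conjAction_apply]
  rfl

lemma matrixCoeff_mem (φ : Module.Dual ℝ (V →L[ℝ] V)) (g : V →L[ℝ] V) :
    matrixCoeff ρ H φ g ∈ coeffSpace ρ H :=
  Submodule.subset_span ⟨φ, g, rfl⟩

/-- A linear identity between functionals on `C(Ad_ρ)` can be checked on matrix coefficients. -/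
lemma coeffSpace_ext {ρ : G →* (V →L[ℝ] V)} {H : Subgroup G}
    {α β : coeffSpace ρ H →ₗ[ℝ] ℝ}
    (h : ∀ φ g, α ⟨_, matrixCoeff_mem ρ H φ g⟩ = β ⟨_, matrixCoeff_mem ρ H φ g⟩) : α = β := by
  ext ⟨f, hf⟩
  induction hf using Submodule.span_induction with
  | mem f hf =>
    obtain ⟨φ, g, rfl⟩ := hf
    exact h φ g
  | zero => exact (map_zero α).trans (map_zero β).symm
  | add f f' hf hf' h₁ h₂ =>
    calc α (⟨f, hf⟩ + ⟨f', hf'⟩) = β (⟨f, hf⟩ + ⟨f', hf'⟩) := by rw [map_add, map_add, h₁, h₂]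
  | smul t f hf h₁ =>
    calc α (t • ⟨f, hf⟩) = β (t • ⟨f, hf⟩) := by rw [map_smul, map_smul, h₁]

/-- Right translation by an element of `H`, as a linear map. -/
def rightTranslateₗ (h' : H) : coeffSpace ρ H →ₗ[ℝ] coeffSpace ρ H where
  toFun := rightTranslate ρ H h'
  map_add' _ _ := rfl
  map_smul' _ _ := rfl

lemma rightTranslate_matrixCoeff (φ : Module.Dual ℝ (V →L[ℝ] V)) (g : V →L[ℝ] V) (h' : H) :
    rightTranslate ρ H h' ⟨_, matrixCoeff_mem ρ H φ g⟩ =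
      ⟨_, matrixCoeff_mem ρ H φ (conjAction (ρ.comp H.subtype) h' g)⟩ := by
  refine Subtype.ext (funext fun h => ?_)
  change matrixCoeff ρ H φ g (h * h') = matrixCoeff ρ H φ _ h
  rw [matrixCoeff_apply, matrixCoeff_apply, map_mul, Module.End.mul_apply]

end

variable [InnerProductSpace ℝ V] {ρ : G →* (V →L[ℝ] V)} {H : Subgroup G}

/-- The bound `π f ≤ c M` for functions `f` bounded by `M` on `Ω`. -/
lemma apply_le_cConst_mul {π : coeffSpace ρ H →ₗ[ℝ] ℝ} {Ω : Set H} {c : ℝ}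
    (hc : cConst ρ H π Ω = c) {M : ℝ} (hM : 0 < M) (f : coeffSpace ρ H)
    (hf : ∀ x ∈ Ω, |(f : H → ℝ) x| ≤ M) : π f ≤ c * M := by
  have h1 : ((π (M⁻¹ • f) : ℝ) : EReal) ≤ c := by
    rw [← hc]
    refine le_iSup₂_of_le (f := fun f (_ : f ∈ {f : coeffSpace ρ H |
      ∀ x ∈ Ω, |(f : H → ℝ) x| ≤ 1}) => ((π f : ℝ) : EReal)) (M⁻¹ • f) (fun x hx => ?_) le_rfl
    change |M⁻¹ * (f : H → ℝ) x| ≤ 1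
    rw [abs_mul, abs_of_pos (inv_pos.2 hM), inv_mul_le_iff₀ hM, mul_one]
    exact hf x hx
  rw [EReal.coe_le_coe_iff, map_smul, smul_eq_mul, inv_mul_le_iff₀ hM] at h1
  linarith

variable [FiniteDimensional ℝ V]

lemma const_one_mem [Nontrivial V] : (fun _ => 1 : H → ℝ) ∈ coeffSpace ρ H := by
  have h1 : opTrace V 1 = Module.finrank ℝ V := LinearMap.trace_one ℝ V
  have h2 : (Module.finrank ℝ V : ℝ) ≠ 0 := Nat.cast_ne_zero.2 Module.finrank_pos.ne'
  convert matrixCoeff_mem ρ H ((Module.finrank ℝ V : ℝ)⁻¹ • opTrace V) 1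
  rw [matrixCoeff_apply, (conjAction_eq_self_iff _ _ _).2 (by rw [mul_one, one_mul]),
    LinearMap.smul_apply, h1, smul_eq_mul, inv_mul_cancel₀ h2]

/-- If `ρ(H)` is self-adjoint, there is an `H`-equivariant projector of `C(Ad_ρ)` onto the
constants, which averages the values of a function with the weights of the mean `P` of conjugation,
and every such projector sends the coefficient of `φ` and `g` to `φ (P g)`. -/
lemma exists_constProjector [Nontrivial V] (hr : IsSelfAdjointGroup (ρ.comp H.subtype)) :
    ∃ P : Module.End ℝ (V →L[ℝ] V),
      (∀ h g, conjAction (ρ.comp H.subtype) h (P g) = P g) ∧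
      (∀ g z, (∀ h, conjAction (ρ.comp H.subtype) h z = z) → hsForm (P g) z = hsForm g z) ∧
      (∃ π, IsConstProjector ρ H π) ∧
      ∀ π, IsConstProjector ρ H π → ∀ φ g, π ⟨_, matrixCoeff_mem ρ H φ g⟩ = φ (P g) := by
  obtain ⟨c, P, hPc, hfix, hinv, hproj⟩ := exists_conj_mean hr
  -- The weights add up to `1`, because the identity is invariant under conjugation.
  have hweights : (c.sum fun _ t => t) = 1 := by
    have hone : ∀ h, conjAction (ρ.comp H.subtype) h 1 = 1 := fun h =>
      (conjAction_eq_self_iff _ _ _).2 (by rw [mul_one, one_mul])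
    have h1 : P 1 = 1 := by
      by_contra hne
      refine (hsForm_pos _ (sub_ne_zero.2 hne)).ne' ?_
      rw [LinearMap.map_sub₂, hproj 1 _ fun h => by rw [map_sub, hfix, hone], sub_self]
    have h2 := hPc 1
    simp only [hone] at h2
    rw [Finsupp.sum, ← Finset.sum_smul, h1] at h2
    exact (smul_left_injective ℝ (one_ne_zero (α := V →L[ℝ] V))
      (by simpa [Finsupp.sum] using h2)).symm
  refine ⟨P, hfix, hproj, ?_, ?_⟩
  · let π : coeffSpace ρ H →ₗ[ℝ] ℝ :=
      (∑ h ∈ c.support, c h • LinearMap.proj h) ∘ₗ (coeffSpace ρ H).subtype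
    have hπ : ∀ f : coeffSpace ρ H, π f = c.sum fun h t => t * (f : H → ℝ) h := fun f => by
      simp [π, Finsupp.sum]
    have hcoeff : ∀ φ g, π ⟨_, matrixCoeff_mem ρ H φ g⟩ = φ (P g) := fun φ g => by
      rw [hπ, hPc, Finsupp.sum, Finsupp.sum, map_sum]
      exact Finset.sum_congr rfl fun h _ => by
        rw [map_smul, smul_eq_mul, ← matrixCoeff_apply]
    refine ⟨π, fun h' f => ?_, fun f a hf => ?_⟩
    · suffices h : π ∘ₗ rightTranslateₗ ρ H h' = π from LinearMap.congr_fun h f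
      refine coeffSpace_ext fun φ g => ?_
      change π (rightTranslate ρ H h' _) = _
      rw [rightTranslate_matrixCoeff, hcoeff, hcoeff, hinv]
    · simp only [hπ, hf]
      rw [← Finsupp.sum_mul, hweights, one_mul]
  · -- By equivariance, `π` does not see the difference between `g` and its conjugates, hence
    -- between `g` and `P g`, and the coefficient of `P g` is constant.
    intro π hπ φ g
    let ψ : (V →L[ℝ] V) →ₗ[ℝ] ℝ := π ∘ₗ
      { toFun := fun x => ⟨_, matrixCoeff_mem ρ H φ x⟩
        map_add' := fun x y => Subtype.ext (funext fun h => by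
          simp [matrixCoeff_apply])
        map_smul' := fun t x => Subtype.ext (funext fun h => by
          simp [matrixCoeff_apply]) }
    have hψ : ∀ x, ψ x = π ⟨_, matrixCoeff_mem ρ H φ x⟩ := fun x => rfl
    have hψinv : ∀ h x, ψ (conjAction (ρ.comp H.subtype) h x) = ψ x := fun h x => by
      rw [hψ, ← rightTranslate_matrixCoeff, hπ.equivariant, hψ]
    have hψfix : ∀ x, (∀ h, conjAction (ρ.comp H.subtype) h x = x) → ψ x = φ x := fun x hx =>
      hπ.apply_const _ _ fun h => by
        change matrixCoeff ρ H φ x h = _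
        rw [matrixCoeff_apply, hx]
    rw [← hψfix (P g) fun h => hfix h g, ← hψ, ← one_mul (ψ g), ← hweights, hPc, Finsupp.sum,
      Finsupp.sum, map_sum,
      Finset.sum_mul]
    exact Finset.sum_congr rfl fun h _ => by rw [map_smul, smul_eq_mul, hψinv]

/-- Uniqueness of the projector onto the constants. -/
lemma existsUnique_constProjector [Nontrivial V] (hr : IsSelfAdjointGroup (ρ.comp H.subtype)) :
    ∃! π, IsConstProjector ρ H π := by
  obtain ⟨P, -, -, ⟨π, hπ⟩, hP⟩ := exists_constProjector hr
  exact ⟨π, hπ, fun π' hπ' => coeffSpace_ext fun φ g => by rw [hP π hπ, hP π' hπ']⟩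

instance finiteDimensional_coeffSpace : FiniteDimensional ℝ (coeffSpace ρ H) := by
  let L : Module.Dual ℝ (Module.End ℝ (V →L[ℝ] V)) →ₗ[ℝ] (H → ℝ) :=
    { toFun := fun l h => l (conjAction (ρ.comp H.subtype) h)
      map_add' := fun _ _ => rfl
      map_smul' := fun _ _ => rfl }
  refine Submodule.finiteDimensional_of_le (S₂ := LinearMap.range L) (Submodule.span_le.2 ?_)
  rintro _ ⟨φ, g, rfl⟩
  exact ⟨φ ∘ₗ LinearMap.applyₗ g, funext fun h => (matrixCoeff_apply ρ H φ g h).symm⟩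

/-! ### The constant `c` -/

/-- If no nonzero element of `C(Ad_ρ)` vanishes on `Ω`, every linear functional on `C(Ad_ρ)` is a
combination of evaluations at points of `Ω`, so that `c` is finite. -/
lemma cConst_lt_top {Ω : Set H} (hstar : ∀ f ∈ coeffSpace ρ H, (∀ x ∈ Ω, f x = 0) → ∀ h, f h = 0)
    (π : coeffSpace ρ H →ₗ[ℝ] ℝ) : cConst ρ H π Ω < ⊤ := by
  let ev : Ω → Module.Dual ℝ (coeffSpace ρ H) := fun x =>
    (LinearMap.proj (x : H)) ∘ₗ (coeffSpace ρ H).subtype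
  have htop : Submodule.span ℝ (Set.range ev) = ⊤ := by
    rw [← Subspace.dualCoannihilator_dualAnnihilator_eq (W := Submodule.span ℝ (Set.range ev)),
      eq_top_iff]
    intro l _
    rw [Submodule.mem_dualAnnihilator]
    intro f hf
    have hf0 : f = 0 := by
      refine Subtype.ext (funext fun h => hstar f f.2 (fun x hx => ?_) h)
      exact (Submodule.mem_dualCoannihilator f).1 hf _ (Submodule.subset_span ⟨⟨x, hx⟩, rfl⟩)
    rw [hf0, map_zero]
  obtain ⟨a, ha⟩ := Finsupp.mem_span_range_iff_exists_finsupp.1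
    (htop ▸ Submodule.mem_top : π ∈ Submodule.span ℝ (Set.range ev))
  refine lt_of_le_of_lt ?_ (EReal.coe_lt_top (a.sum fun _ t => |t|))
  refine iSup₂_le fun f hf => EReal.coe_le_coe_iff.2 ?_
  rw [← ha, Finsupp.sum, Finsupp.sum, LinearMap.sum_apply]
  refine Finset.sum_le_sum fun x _ => (le_abs_self _).trans ?_
  rw [LinearMap.smul_apply, smul_eq_mul, abs_mul]
  exact mul_le_of_le_one_right (abs_nonneg _) (hf x x.2)

lemma one_le_cConst [Nontrivial V] {π : coeffSpace ρ H →ₗ[ℝ] ℝ} (hπ : IsConstProjector ρ H π)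
    (Ω : Set H) : 1 ≤ cConst ρ H π Ω := by
  have h1 : π ⟨_, const_one_mem⟩ = 1 := hπ.apply_const _ 1 fun _ => rfl
  refine le_trans (le_of_eq ?_)
    (le_iSup₂_of_le (f := fun f (_ : f ∈ {f : coeffSpace ρ H | ∀ x ∈ Ω, |(f : H → ℝ) x| ≤ 1}) =>
      ((π f : ℝ) : EReal)) ⟨_, const_one_mem⟩ (fun x _ => by simp) le_rfl)
  rw [h1, EReal.coe_one]

/-- If `T ≥ 1 + Y` as quadratic forms and `Y` is orthogonal to the commutant of `ρ(H)`, the constant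
`c` controls the conjugates of `T` by `Ω`. -/
lemma norm_div_cConst_le (hr : IsSelfAdjointGroup (ρ.comp H.subtype)) {Ω : Set H}
    (hΩ : Ω.Nonempty) [Nontrivial V]
    (hstar : ∀ f ∈ coeffSpace ρ H, (∀ x ∈ Ω, f x = 0) → ∀ h, f h = 0)
    {π : coeffSpace ρ H →ₗ[ℝ] ℝ} (hπ : IsConstProjector ρ H π) (T Y : V →L[ℝ] V)
    (hT : ∀ u, inner ℝ u u + inner ℝ u (Y u) ≤ inner ℝ u (T u))
    (hY : ∀ b : V →L[ℝ] V, (∀ h : H, ρ h * b = b * ρ h) → opTrace V (Y * b) = 0) (v : V) :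
    ((‖v‖ : ℝ) : EReal) / cConst ρ H π Ω ≤
      ⨆ x ∈ Ω, ((‖(ρ ((x : G)⁻¹) * T * ρ (x : G)) v‖ : ℝ) : EReal) := by
  obtain ⟨P, hfix, hproj, -, hP⟩ := exists_constProjector hr
  have hc1 := one_le_cConst hπ Ω
  have hctop := cConst_lt_top hstar π
  obtain ⟨c, hc⟩ : ∃ c : ℝ, cConst ρ H π Ω = c :=
    ⟨_, (EReal.coe_toReal hctop.ne (fun hbot => by
      rw [hbot, le_bot_iff] at hc1
      exact absurd hc1 (EReal.coe_ne_bot 1))).symm⟩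
  have hc0 : 1 ≤ c := by rw [hc] at hc1; exact_mod_cast hc1
  rw [hc, ← EReal.coe_div]
  by_contra hlt
  obtain ⟨M, hM1, hM2⟩ := EReal.lt_iff_exists_real_btwn.1 (not_le.1 hlt)
  rw [EReal.coe_lt_coe_iff, lt_div_iff₀ (by linarith)] at hM2
  have hb : ∀ x ∈ Ω, ‖(ρ ((x : G)⁻¹) * T * ρ (x : G)) v‖ < M := fun x hx =>
    EReal.coe_lt_coe_iff.1 (lt_of_le_of_lt (le_iSup₂_of_le (f := fun (x : H) (_ : x ∈ Ω) =>
      ((‖(ρ ((x : G)⁻¹) * T * ρ (x : G)) v‖ : ℝ) : EReal)) x hx le_rfl) hM1)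
  obtain ⟨x₀, hx₀⟩ := hΩ
  have hM : 0 < M := (norm_nonneg _).trans_lt (hb x₀ hx₀)
  have hv : 0 < ‖v‖ := lt_of_le_of_lt (by positivity) hM2
  let φ : Module.Dual ℝ (V →L[ℝ] V) := opTrace V ∘ₗ LinearMap.mulLeft ℝ T
  have hφ : ∀ x, φ x = opTrace V (T * x) := fun x => rfl
  have h1 := norm_sq_le_opTrace_mean hr P hfix hproj T Y hT (fun b hb => hY b hb) v
  rw [← hφ, ← hP π hπ] at h1
  have h2 := apply_le_cConst_mul hc (mul_pos hv hM)
    ⟨_, matrixCoeff_mem ρ H φ (rankOne ℝ v v)⟩ fun x hx => by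
      have h3 : matrixCoeff ρ H φ (rankOne ℝ v v) x =
          inner ℝ v ((ρ ((x : G)⁻¹) * T * ρ (x : G)) v) := by
        rw [← opTrace_mul_rankOne]
        change opTrace V (T * (ρ (x : G) * rankOne ℝ v v * ρ (x : G)⁻¹)) = _
        rw [← mul_assoc, opTrace_mul_comm, ← mul_assoc, ← mul_assoc]
      change |matrixCoeff ρ H φ (rankOne ℝ v v) x| ≤ _
      rw [h3]
      exact (abs_real_inner_le_norm _ _).trans
        (mul_le_mul_of_nonneg_left (hb x hx).le (norm_nonneg _))
  nlinarith

end Coefficients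

section LieGroup

variable {n : ℕ} {G : Type*} [TopologicalSpace G] [ChartedSpace (EuclideanSpace ℝ (Fin n)) G]
  [Group G] [LieGroup (𝓡 n) ∞ G]

/-! ### Smooth homomorphisms and one-parameter subgroups -/

lemma contMDiff_leftMul (g : G) : ContMDiff (𝓡 n) (𝓡 n) ∞ (g * · : G → G) :=
  contMDiff_mul_left

lemma hasMFDerivAt_leftMul (g h : G) :
    HasMFDerivAt (𝓡 n) (𝓡 n) (g * · : G → G) h (mfderiv (𝓡 n) (𝓡 n) (g * · : G → G) h) :=
  ((contMDiff_leftMul g).mdifferentiable (by simp) h).hasMFDerivAt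

lemma comp_smulRight_eq {E E' : Type*} [NormedAddCommGroup E] [NormedSpace ℝ E]
    [NormedAddCommGroup E'] [NormedSpace ℝ E'] {H H' : Type*} [TopologicalSpace H]
    [TopologicalSpace H'] {I : ModelWithCorners ℝ E H} {I' : ModelWithCorners ℝ E' H'}
    {M M' : Type*} [TopologicalSpace M] [ChartedSpace H M] [TopologicalSpace M']
    [ChartedSpace H' M'] {p : M} {q : M'} (L : TangentSpace I p →L[ℝ] TangentSpace I' q)
    {x : TangentSpace I p} {y : TangentSpace I' q} (h : L x = y) :
    L.comp ((1 : ℝ →L[ℝ] ℝ).smulRight x) = (1 : ℝ →L[ℝ] ℝ).smulRight y := by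
  ext; simp [h]

/-- The chain rule for `F ∘ (g * ·)` at the identity. -/
lemma hasMFDerivAt_comp_leftMul {E' : Type*} [NormedAddCommGroup E'] [NormedSpace ℝ E']
    {H' : Type*} [TopologicalSpace H'] {I' : ModelWithCorners ℝ E' H'} {M : Type*}
    [TopologicalSpace M] [ChartedSpace H' M] {F : G → M} (g : G)
    (hF : MDifferentiableAt (𝓡 n) I' F g) (X : GroupLieAlgebra (𝓡 n) G) :
    ∃ L : EuclideanSpace ℝ (Fin n) →L[ℝ] E',
      HasMFDerivAt (𝓡 n) I' (fun x => F (g * x)) 1 L ∧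
      L X = mfderiv (𝓡 n) I' F g (mulInvariantVectorField X g) := by
  have key : ∀ y : G, y = g → ∀ L : EuclideanSpace ℝ (Fin n) →L[ℝ] E',
      HasMFDerivAt (𝓡 n) I' F g L → HasMFDerivAt (𝓡 n) I' F y L := by
    rintro _ rfl L hL
    exact hL
  exact ⟨_, (key (g * 1) (mul_one g) _ hF.hasMFDerivAt).comp 1 (hasMFDerivAt_leftMul g 1), rfl⟩

/-- A smooth endomorphism of `G` maps left-invariant vector fields to left-invariant ones. -/
lemma mfderiv_mulInvariantVectorField {φ : G →* G} (hφ : ContMDiff (𝓡 n) (𝓡 n) ∞ φ)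
    (X : GroupLieAlgebra (𝓡 n) G) (g : G) :
    mfderiv (𝓡 n) (𝓡 n) φ g (mulInvariantVectorField X g) =
      mulInvariantVectorField (differential n φ X) (φ g) := by
  have hd := hφ.mdifferentiable (by simp)
  obtain ⟨L, hL, hLX⟩ := hasMFDerivAt_comp_leftMul g (hd g) X
  have key : ∀ y : G, y = 1 → ∀ L' : EuclideanSpace ℝ (Fin n) →L[ℝ] EuclideanSpace ℝ (Fin n),
      HasMFDerivAt (𝓡 n) (𝓡 n) (φ g * · : G → G) 1 L' →
      HasMFDerivAt (𝓡 n) (𝓡 n) (φ g * · : G → G) y L' := by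
    rintro _ rfl L hL
    exact hL
  have h2 := (key (φ 1) (map_one φ) _ (hasMFDerivAt_leftMul (φ g) 1)).comp 1 (hd 1).hasMFDerivAt
  have h3 : ((φ g * · : G → G) ∘ φ) = fun x => φ (g * x) := funext fun x => (map_mul φ g x).symm
  rw [h3] at h2
  have h4 := hasMFDerivAt_unique hL h2
  rw [← hLX, h4]
  rfl

/-- A smooth endomorphism of `G` maps one-parameter subgroups to one-parameter subgroups. -/
lemma IsExpCurve.map {φ : G →* G} (hφ : ContMDiff (𝓡 n) (𝓡 n) ∞ φ)
    {X : GroupLieAlgebra (𝓡 n) G} {γ : ℝ → G} (hγ : IsExpCurve X γ) :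
    IsExpCurve (differential n φ X) (φ ∘ γ) := by
  refine ⟨by rw [Function.comp_apply, hγ.1, map_one], fun t => ?_⟩
  have h1 := ((hφ.mdifferentiable (by simp)) (γ t)).hasMFDerivAt.comp t (hγ.2 t)
  exact h1.congr_mfderiv (comp_smulRight_eq _ (mfderiv_mulInvariantVectorField hφ X (γ t)))

lemma contMDiff_mulInvariantVectorField_one (X : GroupLieAlgebra (𝓡 n) G) :
    ContMDiff (𝓡 n) (𝓡 n).tangent 1
      (fun g => (⟨g, mulInvariantVectorField X g⟩ : TangentBundle (𝓡 n) G)) :=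
  (contMDiff_mulInvariantVectorField X).of_le (by
    simp only [minSmoothness_of_isRCLikeNormedField]; norm_num)

variable [T2Space G]

lemma IsExpCurve.unique {X : GroupLieAlgebra (𝓡 n) G} {γ γ' : ℝ → G} (hγ : IsExpCurve X γ)
    (hγ' : IsExpCurve X γ') : γ = γ' :=
  isMIntegralCurve_Ioo_eq_of_contMDiff_boundaryless (t₀ := 0)
    (contMDiff_mulInvariantVectorField_one X) hγ.2 hγ'.2 (hγ.1.trans hγ'.1.symm)

/-- Every element of the Lie algebra generates a one-parameter subgroup: left translations carry an
integral curve at the identity to integral curves at all points, with the same interval of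
definition. -/
lemma exists_isExpCurve (X : GroupLieAlgebra (𝓡 n) G) : ∃ γ : ℝ → G, IsExpCurve X γ := by
  have hv := contMDiff_mulInvariantVectorField_one X
  obtain ⟨γ, hγ0, hγ⟩ := exists_isMIntegralCurveAt_of_contMDiffAt_boundaryless 0
    (hv.contMDiffAt (x := (1 : G)))
  obtain ⟨ε, hε, hγε⟩ := isMIntegralCurveAt_iff'.1 hγ
  rw [Real.ball_eq_Ioo, zero_sub, zero_add] at hγε
  refine exists_isMIntegralCurve_of_isMIntegralCurveOn hv hε (fun g => ⟨fun t => g * γ t, ?_, ?_⟩) 1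
  · change g * γ 0 = g
    rw [hγ0, mul_one]
  · intro t ht
    have h1 := (hasMFDerivAt_leftMul g (γ t)).comp_hasMFDerivWithinAt t (hγε t ht)
    refine h1.congr_mfderiv (comp_smulRight_eq _ ?_)
    obtain ⟨L, hL, hLX⟩ := hasMFDerivAt_comp_leftMul (γ t)
      ((contMDiff_leftMul (n := n) g).mdifferentiable (by simp) (γ t)) X
    rw [← hLX]
    have h2 : (fun x => g * (γ t * x)) = fun x => g * γ t * x :=
      funext fun x => (mul_assoc _ _ _).symm
    rw [h2] at hL
    rw [hasMFDerivAt_unique hL (hasMFDerivAt_leftMul (g * γ t) 1)]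
    rfl

/-- The Lie algebra of the fixed points of an endomorphism contains the fixed vectors of its
differential. -/
lemma mem_lieAlgebraOf_fixedSubgroup {φ : G →* G} (hφ : ContMDiff (𝓡 n) (𝓡 n) ∞ φ)
    {X : GroupLieAlgebra (𝓡 n) G} (hX : differential n φ X = X) :
    X ∈ lieAlgebraOf n (fixedSubgroup φ) := by
  obtain ⟨γ, hγ⟩ := exists_isExpCurve X
  have h1 := hγ.map hφ
  rw [hX] at h1
  exact ⟨γ, hγ, fun t => congrFun (h1.unique hγ) t⟩

end LieGroup

section LieGroup

variable {n : ℕ} {G : Type*} [TopologicalSpace G] [ChartedSpace (EuclideanSpace ℝ (Fin n)) G]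
  [Group G]

/-! ### The adjoint representation and the Killing form -/

lemma conj_comp_conj_inv {G : Type*} [Group G] (g : G) : ((MulAut.conj g).toMonoidHom).comp
    (MulAut.conj g⁻¹).toMonoidHom = MonoidHom.id G := by
  ext x; simp [mul_assoc]

lemma differential_id (X : GroupLieAlgebra (𝓡 n) G) : differential n (MonoidHom.id G) X = X := by
  have h1 : mfderiv (𝓡 n) (𝓡 n) (id : G → G) 1 = ContinuousLinearMap.id ℝ _ := mfderiv_id
  exact congr($h1 X)

/-- The chain rule, in a form that tolerates points that are equal without being so by
definition. -/
lemma mfderiv_comp_apply_of_eq {G : Type*} [TopologicalSpace G]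
    [ChartedSpace (EuclideanSpace ℝ (Fin n)) G] {F f : G → G} {x y : G}
    (hF : MDifferentiableAt (𝓡 n) (𝓡 n) F y) (hf : MDifferentiableAt (𝓡 n) (𝓡 n) f x)
    (h : f x = y) (v : EuclideanSpace ℝ (Fin n)) :
    (mfderiv (𝓡 n) (𝓡 n) (F ∘ f) x v : EuclideanSpace ℝ (Fin n)) =
      (mfderiv (𝓡 n) (𝓡 n) F y : EuclideanSpace ℝ (Fin n) →L[ℝ] EuclideanSpace ℝ (Fin n))
        (mfderiv (𝓡 n) (𝓡 n) f x v) := by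
  subst h
  rw [mfderiv_comp x hF hf]
  rfl

lemma differential_comp {φ ψ : G →* G} (hφ : ContMDiff (𝓡 n) (𝓡 n) ∞ φ)
    (hψ : ContMDiff (𝓡 n) (𝓡 n) ∞ ψ) (X : GroupLieAlgebra (𝓡 n) G) :
    differential n (φ.comp ψ) X = differential n φ (differential n ψ X) :=
  mfderiv_comp_apply_of_eq (hφ.mdifferentiable (by simp) 1)
    (hψ.mdifferentiable (by simp) 1) (map_one ψ) X

variable [LieGroup (𝓡 n) ∞ G]

lemma mulInvariantVectorField_apply_one (X : GroupLieAlgebra (𝓡 n) G) :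
    mulInvariantVectorField X 1 = X := by
  have h : (((1 : G) * ·) : G → G) = id := funext one_mul
  obtain ⟨L, hL, hLX⟩ := hasMFDerivAt_comp_leftMul (1 : G) (mdifferentiableAt_id (I := 𝓡 n)) X
  rw [show (fun x : G => id (1 * x)) = id from h] at hL
  rw [hasMFDerivAt_unique hL (hasMFDerivAt_id 1), mfderiv_id] at hLX
  exact hLX.symm

/-- A smooth automorphism of `G` pulls left-invariant vector fields back to left-invariant ones. -/
lemma mpullback_mulInvariantVectorField_hom {φ ψ : G →* G} (hφ : ContMDiff (𝓡 n) (𝓡 n) ∞ φ)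
    (hψ : ContMDiff (𝓡 n) (𝓡 n) ∞ ψ) (hφψ : φ.comp ψ = MonoidHom.id G)
    (hψφ : ψ.comp φ = MonoidHom.id G) (X : GroupLieAlgebra (𝓡 n) G) :
    VectorField.mpullback (𝓡 n) (𝓡 n) φ (mulInvariantVectorField X) =
      mulInvariantVectorField (differential n ψ X) := by
  funext g
  have hX : differential n φ (differential n ψ X) = X := by
    rw [← differential_comp hφ hψ, hφψ, differential_id]
  have h1 : (mfderiv (𝓡 n) (𝓡 n) ψ (φ g)).comp (mfderiv (𝓡 n) (𝓡 n) φ g) =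
      ContinuousLinearMap.id ℝ _ := by
    rw [← mfderiv_comp (I' := 𝓡 n) g (hψ.mdifferentiable (by simp) _)
      (hφ.mdifferentiable (by simp) _)]
    have : (ψ ∘ φ : G → G) = id := congrArg DFunLike.coe hψφ
    rw [this, mfderiv_id]
  have h2 : (mfderiv (𝓡 n) (𝓡 n) φ g).comp (mfderiv (𝓡 n) (𝓡 n) ψ (φ g)) =
      ContinuousLinearMap.id ℝ _ := by
    have h3 := mfderiv_comp_apply_of_eq (hφ.mdifferentiable (by simp) g)
      (hψ.mdifferentiable (by simp) (φ g)) (congr($hψφ g) : ψ (φ g) = g)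
    have h4 : (φ ∘ ψ : G → G) = id := congrArg DFunLike.coe hφψ
    rw [h4, mfderiv_id] at h3
    exact ContinuousLinearMap.ext fun v => (h3 v).symm
  rw [VectorField.mpullback_apply]
  have h3 := mfderiv_mulInvariantVectorField hφ (differential n ψ X) g
  rw [hX] at h3
  rw [← h3, ContinuousLinearMap.inverse_eq h2 h1]
  exact congr($h1 _)

/-- The differential of a smooth automorphism of `G` is an automorphism of its Lie algebra. -/
lemma differential_lie {φ ψ : G →* G} (hφ : ContMDiff (𝓡 n) (𝓡 n) ∞ φ)
    (hψ : ContMDiff (𝓡 n) (𝓡 n) ∞ ψ) (hφψ : φ.comp ψ = MonoidHom.id G)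
    (hψφ : ψ.comp φ = MonoidHom.id G) (X Y : GroupLieAlgebra (𝓡 n) G) :
    differential n ψ ⁅X, Y⁆ = ⁅differential n ψ X, differential n ψ Y⁆ := by
  have key := VectorField.mpullback_mlieBracket (n := minSmoothness ℝ 3) (I := 𝓡 n) (I' := 𝓡 n)
    (f := φ) (x₀ := (1 : G)) (V := mulInvariantVectorField X) (W := mulInvariantVectorField Y)
    (mdifferentiableAt_mulInvariantVectorField X) (mdifferentiableAt_mulInvariantVectorField Y)
    (hφ.contMDiffAt.of_le (by
      simp only [minSmoothness_of_isRCLikeNormedField]; exact ENat.LEInfty.out))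
    (minSmoothness_monotone (by norm_cast))
  rw [← mulInvariantVector_mlieBracket, ← GroupLieAlgebra.bracket_def,
    mpullback_mulInvariantVectorField_hom hφ hψ hφψ hψφ,
    mpullback_mulInvariantVectorField_hom hφ hψ hφψ hψφ,
    mpullback_mulInvariantVectorField_hom hφ hψ hφψ hψφ,
    mulInvariantVectorField_apply_one] at key
  exact key

variable (n) in
/-- The adjoint action of an element of `G` on the Lie algebra. -/
def Ad (g : G) : GroupLieAlgebra (𝓡 n) G →L[ℝ] GroupLieAlgebra (𝓡 n) G :=
  differential n (MulAut.conj g).toMonoidHom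

lemma contMDiff_conj (g : G) : ContMDiff (𝓡 n) (𝓡 n) ∞ (MulAut.conj g).toMonoidHom :=
  (contMDiff_mul_right (I := 𝓡 n) (n := ∞) (a := g⁻¹)).comp (contMDiff_leftMul g)

lemma Ad_Ad_inv (g : G) (X : GroupLieAlgebra (𝓡 n) G) : Ad n g (Ad n g⁻¹ X) = X := by
  rw [Ad, Ad, ← differential_comp (contMDiff_conj g) (contMDiff_conj g⁻¹), conj_comp_conj_inv,
    differential_id]

/-- The adjoint action of an element of `G` as an automorphism of the Lie algebra. -/
def AdEquiv (g : G) : GroupLieAlgebra (𝓡 n) G ≃ₗ⁅ℝ⁆ GroupLieAlgebra (𝓡 n) G where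
  toFun := Ad n g
  map_add' := map_add _
  map_smul' := map_smul _
  map_lie' {X Y} := by
    have h := conj_comp_conj_inv g⁻¹
    rw [inv_inv] at h
    exact differential_lie (contMDiff_conj g⁻¹) (contMDiff_conj g) h (conj_comp_conj_inv g) X Y
  invFun := Ad n g⁻¹
  left_inv X := by simpa using Ad_Ad_inv g⁻¹ X
  right_inv X := Ad_Ad_inv g X

lemma killingForm_Ad (g : G) (X Y : GroupLieAlgebra (𝓡 n) G) :
    killingForm ℝ (GroupLieAlgebra (𝓡 n) G) (Ad n g X) (Ad n g Y) =
      killingForm ℝ (GroupLieAlgebra (𝓡 n) G) X Y :=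
  LieAlgebra.killingForm_of_equiv_apply (AdEquiv g) X Y

/-- The Lie algebra of the centraliser of `H` contains the vectors fixed by the adjoint action of
`H`. -/
lemma mem_lieAlgebraOf_centralizer [T2Space G] {H : Subgroup G} {X : GroupLieAlgebra (𝓡 n) G}
    (hX : ∀ h ∈ H, Ad n h X = X) :
    X ∈ lieAlgebraOf n (Subgroup.centralizer (H : Set G)) := by
  obtain ⟨γ, hγ⟩ := exists_isExpCurve X
  refine ⟨γ, hγ, fun t => Subgroup.mem_centralizer_iff.2 fun h hh => ?_⟩
  have h1 := hγ.map (contMDiff_conj h)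
  rw [show differential n (MulAut.conj h).toMonoidHom X = X from hX h hh] at h1
  have h2 : h * γ t * h⁻¹ = γ t := congrFun (h1.unique hγ) t
  exact mul_inv_eq_iff_eq_mul.1 h2

end LieGroup

/-! ### Functions with vanishing derivative -/

/-- A function on a connected manifold with vanishing derivative is constant. -/
lemma eq_of_mfderiv_eq_zero {E : Type*} [NormedAddCommGroup E] [NormedSpace ℝ E] {M : Type*}
    [TopologicalSpace M] [ChartedSpace E M] [IsManifold 𝓘(ℝ, E) 1 M] [PreconnectedSpace M]
    {W : Type*} [NormedAddCommGroup W] [NormedSpace ℝ W] {F : M → W}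
    (hF : ∀ x, HasMFDerivAt 𝓘(ℝ, E) 𝓘(ℝ, W) F x (0 : E →L[ℝ] W)) (x y : M) : F x = F y := by
  refine IsLocallyConstant.apply_eq_of_preconnectedSpace (IsLocallyConstant.iff_eventually_eq F |>.2
    fun x => ?_) x y
  let e := extChartAt 𝓘(ℝ, E) x
  have hopen : IsOpen e.target := isOpen_extChartAt_target x
  have hderiv : ∀ z ∈ e.target, HasFDerivAt (F ∘ e.symm) (0 : E →L[ℝ] W) z := by
    intro z hz
    have h1 := (mdifferentiableOn_extChartAt_symm (I := 𝓘(ℝ, E)) (x := x) z hz).mdifferentiableAt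
      (hopen.mem_nhds hz)
    have h2 := (hF (e.symm z)).comp z h1.hasMFDerivAt
    exact hasMFDerivAt_iff_hasFDerivAt.1 (h2.congr_mfderiv (ContinuousLinearMap.zero_comp _))
  have hloc := hopen.isOpen_inter_preimage_of_fderiv_eq_zero (𝕜 := ℝ) (f := F ∘ e.symm)
    (fun z hz => (hderiv z hz).differentiableAt.differentiableWithinAt)
    (fun z hz => (hderiv z hz).fderiv) {F x}
  have hx : e x ∈ e.target ∩ (F ∘ e.symm) ⁻¹' {F x} :=
    ⟨mem_extChartAt_target x, by simp [e]⟩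
  have hnhds := (continuousAt_extChartAt (I := 𝓘(ℝ, E)) x).preimage_mem_nhds (hloc.mem_nhds hx)
  filter_upwards [hnhds, extChartAt_source_mem_nhds (I := 𝓘(ℝ, E)) x] with z hz hz'
  have h1 : F (e.symm (e z)) = F x := hz.2
  rwa [e.left_inv hz'] at h1

/-! ### Smooth representations and their tangent representations -/

section AdaptedDifferential

variable {n : ℕ} {G : Type*} [TopologicalSpace G] [ChartedSpace (EuclideanSpace ℝ (Fin n)) G]
  [Group G] {V : Type*} [NormedAddCommGroup V] [InnerProductSpace ℝ V] {ρ : G →* (V →L[ℝ] V)}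
  {Θ : G →* G}

lemma IsAdapted.tangentRep_eq [CompleteSpace V] (hV : IsAdapted n Θ ρ)
    (X : GroupLieAlgebra (𝓡 n) G) :
    tangentRep n ρ (differential n Θ X) = -ContinuousLinearMap.adjoint (tangentRep n ρ X) := by
  ext v
  refine ext_inner_right ℝ fun w => ?_
  rw [hV, neg_apply, inner_neg_left, ContinuousLinearMap.adjoint_inner_left]

end AdaptedDifferential

/-- The derivative of a vector-valued function along a curve. -/
lemma hasDerivAt_comp_curve {E : Type*} [NormedAddCommGroup E] [NormedSpace ℝ E] {H : Type*}
    [TopologicalSpace H] {I : ModelWithCorners ℝ E H} {M : Type*} [TopologicalSpace M]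
    [ChartedSpace H M] {W : Type*} [NormedAddCommGroup W] [NormedSpace ℝ W] {F : M → W}
    {γ : ℝ → M} {t : ℝ} (hF : MDifferentiableAt I 𝓘(ℝ, W) F (γ t)) {x : TangentSpace I (γ t)}
    (hγ : HasMFDerivAt 𝓘(ℝ, ℝ) I γ t ((1 : ℝ →L[ℝ] ℝ).smulRight x)) :
    HasDerivAt (F ∘ γ) (mfderiv I 𝓘(ℝ, W) F (γ t) x) t := by
  have h1 := hF.hasMFDerivAt.comp t hγ
  let x' : E := x
  let L : E →L[ℝ] W := mfderiv I 𝓘(ℝ, W) F (γ t)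
  have h2 : HasFDerivAt (F ∘ γ) (L.comp ((1 : ℝ →L[ℝ] ℝ).smulRight x')) t :=
    hasMFDerivAt_iff_hasFDerivAt.1 h1
  have h3 : HasDerivAt (F ∘ γ) (L x') t := by simpa using h2.hasDerivAt
  exact h3

section LieGroup

variable {n : ℕ} {G : Type*} [TopologicalSpace G] [ChartedSpace (EuclideanSpace ℝ (Fin n)) G]
  [Group G] [LieGroup (𝓡 n) ∞ G]

/-- Every tangent vector is a value of a left-invariant vector field. -/
lemma exists_mulInvariantVectorField_eq (g : G) (w : TangentSpace (𝓡 n) g) :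
    ∃ X : GroupLieAlgebra (𝓡 n) G, mulInvariantVectorField X g = w := by
  have h1 := mfderiv_comp_apply_of_eq (hasMFDerivAt_leftMul (n := n) g 1).mdifferentiableAt
    (hasMFDerivAt_leftMul g⁻¹ g).mdifferentiableAt (inv_mul_cancel g) w
  have h2 : ((g * ·) ∘ (g⁻¹ * ·) : G → G) = id := funext fun x => mul_inv_cancel_left g x
  rw [h2, mfderiv_id] at h1
  exact ⟨mfderiv (𝓡 n) (𝓡 n) (g⁻¹ * · : G → G) g w, h1.symm⟩

section Representation

variable {V : Type*} [NormedAddCommGroup V] [NormedSpace ℝ V] {ρ : G →* (V →L[ℝ] V)}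

lemma mfderiv_rep_mulInvariantVectorField (hρ : ContMDiff (𝓡 n) 𝓘(ℝ, V →L[ℝ] V) ∞ ρ)
    (X : GroupLieAlgebra (𝓡 n) G) (g : G) :
    (mfderiv (𝓡 n) 𝓘(ℝ, V →L[ℝ] V) ρ g (mulInvariantVectorField X g) : V →L[ℝ] V) =
      ρ g * tangentRep n ρ X := by
  have hd := hρ.mdifferentiable (by simp)
  obtain ⟨L, hL, hLX⟩ := hasMFDerivAt_comp_leftMul g (hd g) X
  have h2 := ((ContinuousLinearMap.mul ℝ (V →L[ℝ] V) (ρ g)).hasMFDerivAt (x := ρ 1)).comp 1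
    (hd 1).hasMFDerivAt
  have h3 : (ContinuousLinearMap.mul ℝ (V →L[ℝ] V) (ρ g)) ∘ ρ = fun x => ρ (g * x) :=
    funext fun x => (map_mul ρ g x).symm
  rw [h3] at h2
  rw [← hLX, hasMFDerivAt_unique hL h2]
  rfl

/-- Along a one-parameter subgroup a representation satisfies a linear differential equation. -/
lemma IsExpCurve.hasDerivAt_rep (hρ : ContMDiff (𝓡 n) 𝓘(ℝ, V →L[ℝ] V) ∞ ρ)
    {X : GroupLieAlgebra (𝓡 n) G} {γ : ℝ → G} (hγ : IsExpCurve X γ) (t : ℝ) :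
    HasDerivAt (fun s => ρ (γ s)) (ρ (γ t) * tangentRep n ρ X) t := by
  rw [← mfderiv_rep_mulInvariantVectorField hρ]
  exact hasDerivAt_comp_curve (hρ.mdifferentiable (by simp) (γ t)) (hγ.2 t)

variable [T2Space G]

lemma tangentRep_Ad (hρ : ContMDiff (𝓡 n) 𝓘(ℝ, V →L[ℝ] V) ∞ ρ) (g : G)
    (X : GroupLieAlgebra (𝓡 n) G) :
    tangentRep n ρ (Ad n g X) = ρ g * tangentRep n ρ X * ρ g⁻¹ := by
  obtain ⟨γ, hγ⟩ := exists_isExpCurve X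
  have h1 := (hγ.map (contMDiff_conj g)).hasDerivAt_rep hρ 0
  have h2 := ((hγ.hasDerivAt_rep hρ 0).const_mul (ρ g)).mul_const (ρ g⁻¹)
  have h3 : (fun s => ρ (((MulAut.conj g).toMonoidHom ∘ γ) s)) =
      fun s => ρ g * ρ (γ s) * ρ g⁻¹ := funext fun s => by simp
  rw [h3] at h1
  have h4 := h1.unique h2
  rw [Function.comp_apply, hγ.1, map_one, map_one, one_mul, one_mul] at h4
  exact h4

end Representation

section Adapted

variable {V : Type*} [NormedAddCommGroup V] [InnerProductSpace ℝ V] {ρ : G →* (V →L[ℝ] V)}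
  {Θ : G →* G}

variable [T2Space G]

/-- The infinitesimal condition on `Θ` and `ρ` integrates to `ρ(Θ g) = (ρ(g)*)⁻¹`: the function
`g ↦ ρ(Θ g) ρ(g)*` has vanishing derivative on the connected group `G`. -/
lemma IsAdapted.rep_mul_adjoint [ConnectedSpace G] [CompleteSpace V]
    (hρ : ContMDiff (𝓡 n) 𝓘(ℝ, V →L[ℝ] V) ∞ ρ) (hΘ : ContMDiff (𝓡 n) (𝓡 n) ∞ Θ)
    (hV : IsAdapted n Θ ρ) (g : G) :
    ρ (Θ g) * ContinuousLinearMap.adjoint (ρ g) = 1 := by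
  let adj : (V →L[ℝ] V) →L[ℝ] (V →L[ℝ] V) :=
    { toFun := ContinuousLinearMap.adjoint
      map_add' := map_add _
      map_smul' := fun t x => by simp
      cont := ContinuousLinearMap.adjoint.continuous }
  have hadj : ∀ x, adj x = ContinuousLinearMap.adjoint x := fun x => rfl
  have hadj1 : adj 1 = 1 := by rw [hadj, ← ContinuousLinearMap.star_eq_adjoint, star_one]
  let F : G → (V →L[ℝ] V) := fun g => ρ (Θ g) * adj (ρ g)
  have hFd : MDifferentiable (𝓡 n) 𝓘(ℝ, V →L[ℝ] V) F := by
    have h1 := (hρ.comp hΘ).mdifferentiable (by simp)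
    have h2 : MDifferentiable (𝓡 n) 𝓘(ℝ, V →L[ℝ] V) (adj ∘ ρ) :=
      adj.mdifferentiable.comp (hρ.mdifferentiable (by simp))
    exact h1.mul h2
  have hmul : ∀ g x, F (g * x) = ρ (Θ g) * (F x) * adj (ρ g) := fun g x => by
    simp only [F, hadj, map_mul, ← ContinuousLinearMap.star_eq_adjoint, star_mul, mul_assoc]
  have hF0 : ∀ g, HasMFDerivAt (𝓡 n) 𝓘(ℝ, V →L[ℝ] V) F g
      (0 : EuclideanSpace ℝ (Fin n) →L[ℝ] V →L[ℝ] V) := by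
    intro g
    refine (hFd g).hasMFDerivAt.congr_mfderiv (ContinuousLinearMap.ext fun w => ?_)
    -- Every tangent vector at `g` is the value of a left-invariant vector field.
    obtain ⟨X, rfl⟩ := exists_mulInvariantVectorField_eq g w
    -- The derivative at `0` of `t ↦ F (g exp (t X)) = ρ(Θ g) F(exp (t X)) ρ(g)*` vanishes.
    obtain ⟨γ, hγ⟩ := exists_isExpCurve X
    have h1 : HasDerivAt (fun t => ρ (Θ (γ t))) (tangentRep n ρ (differential n Θ X)) 0 := by
      simpa [hγ.1] using (hγ.map hΘ).hasDerivAt_rep hρ 0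
    have h2 : HasDerivAt (fun t => adj (ρ (γ t))) (adj (tangentRep n ρ X)) 0 := by
      have := hγ.hasDerivAt_rep hρ 0
      rw [hγ.1, map_one, one_mul] at this
      exact adj.hasFDerivAt.comp_hasDerivAt 0 this
    have h3 : HasDerivAt (fun t => F (γ t)) 0 0 := by
      have := h1.mul h2
      rw [hV.tangentRep_eq, hγ.1, map_one Θ, map_one ρ, hadj1, hadj, mul_one, one_mul,
        neg_add_cancel] at this
      exact this
    have h4 : HasDerivAt (fun t => F (g * γ t)) 0 0 := by
      simp only [hmul]
      simpa using (h3.const_mul (ρ (Θ g))).mul_const (adj (ρ g))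
    obtain ⟨L, hL, hLX⟩ := hasMFDerivAt_comp_leftMul g (hFd g) X
    have h5 : HasDerivAt ((fun x => F (g * x)) ∘ γ) (L X) 0 := by
      have hL' : HasMFDerivAt (𝓡 n) 𝓘(ℝ, V →L[ℝ] V) (fun x => F (g * x)) (γ 0) L :=
        hγ.1.symm ▸ hL
      have hX : ∀ y : G, y = 1 → (mulInvariantVectorField X y : EuclideanSpace ℝ (Fin n)) = X := by
        rintro _ rfl
        exact mulInvariantVectorField_apply_one X
      have := hasDerivAt_comp_curve hL'.mdifferentiableAt (hγ.2 0)
      rw [hL'.mfderiv] at this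
      exact this.congr_deriv (congrArg L (hX _ hγ.1))
    rw [← hLX]
    exact h5.unique h4
  have h1 := eq_of_mfderiv_eq_zero hF0 g 1
  simpa [F, hadj, ← ContinuousLinearMap.star_eq_adjoint] using h1

end Adapted

end LieGroup

section LieGroup

variable {n : ℕ} {G : Type*} [TopologicalSpace G] [ChartedSpace (EuclideanSpace ℝ (Fin n)) G]
  [Group G] [LieGroup (𝓡 n) ∞ G]

/-! ### The subspace `𝔭` -/

section Exponential

variable {V : Type*} [NormedAddCommGroup V] [InnerProductSpace ℝ V] {ρ : G →* (V →L[ℝ] V)}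

/-- If `dρ(X) y = μ y`, then `ρ(exp X) y = exp(μ) y`. -/
lemma IsExpCurve.rep_apply_eigenvector (hρ : ContMDiff (𝓡 n) 𝓘(ℝ, V →L[ℝ] V) ∞ ρ)
    {X : GroupLieAlgebra (𝓡 n) G} {γ : ℝ → G} (hγ : IsExpCurve X γ) {μ : ℝ} {y : V}
    (hy : tangentRep n ρ X y = μ • y) : ρ (γ 1) y = Real.exp μ • y := by
  have h1 : ∀ t, HasDerivAt (fun t => Real.exp (-(μ * t)) • ρ (γ t) y) 0 t := by
    intro t
    have h2 : HasDerivAt (fun t => ρ (γ t) y) (μ • ρ (γ t) y) t := by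
      have := ((ContinuousLinearMap.apply ℝ V y).hasFDerivAt).comp_hasDerivAt t
        (hγ.hasDerivAt_rep hρ t)
      have h3 : (ContinuousLinearMap.apply ℝ V y) (ρ (γ t) * tangentRep n ρ X) =
          μ • ρ (γ t) y := by
        rw [ContinuousLinearMap.apply_apply, mul_apply_eq_comp, hy, map_smul]
      rw [h3] at this
      exact this
    have h3 : HasDerivAt (fun t => Real.exp (-(μ * t))) (Real.exp (-(μ * t)) * -(μ * 1)) t :=
      (((hasDerivAt_id t).const_mul μ).neg).exp
    have h4 := h3.smul h2
    refine h4.congr_deriv ?_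
    rw [smul_smul, ← add_smul, mul_one, mul_neg, add_neg_cancel, zero_smul]
  have h5 := is_const_of_deriv_eq_zero (fun t => (h1 t).differentiableAt)
    (fun t => (h1 t).deriv) 1 0
  rw [hγ.1, map_one, one_apply_eq_self, mul_zero, neg_zero, Real.exp_zero, one_smul, mul_one] at h5
  conv_rhs => rw [← h5, smul_smul, ← Real.exp_add, add_neg_cancel, Real.exp_zero, one_smul]

lemma inner_apply_eq_sum {ι : Type*} [Fintype ι] (b : OrthonormalBasis ι ℝ V) (S : V →L[ℝ] V)
    (s : ι → ℝ) (hS : ∀ i, S (b i) = s i • b i) (u : V) :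
    inner ℝ u (S u) = ∑ i, s i * inner ℝ (b i) u ^ 2 := by
  conv_lhs => rw [← b.sum_repr' u, map_sum]
  rw [b.sum_repr' u, inner_sum]
  refine Finset.sum_congr rfl fun i _ => ?_
  rw [map_smul, hS, inner_smul_right, inner_smul_right, real_inner_comm]
  ring

variable [FiniteDimensional ℝ V]

/-- For `X` in the `-1` eigenspace of the Cartan involution, `ρ(exp X)` is the exponential of the
symmetric operator `dρ(X)`, so that `ρ(exp X) ≥ 1 + dρ(X)`. -/
lemma inner_add_inner_tangentRep_le (hρ : ContMDiff (𝓡 n) 𝓘(ℝ, V →L[ℝ] V) ∞ ρ)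
    {Θ : G →* G} (hV : IsAdapted n Θ ρ) {X : GroupLieAlgebra (𝓡 n) G} (hX : differential n Θ X = -X)
    {γ : ℝ → G} (hγ : IsExpCurve X γ) (u : V) :
    inner ℝ u u + inner ℝ u (tangentRep n ρ X u) ≤ inner ℝ u (ρ (γ 1) u) := by
  have hsymm : ((tangentRep n ρ X : V →L[ℝ] V) : V →ₗ[ℝ] V).IsSymmetric := fun v w => by
    have h1 := hV X v w
    rw [hX, map_neg, neg_apply, inner_neg_left, neg_inj] at h1
    exact h1
  let b := hsymm.eigenvectorBasis rfl
  have hb : ∀ i, tangentRep n ρ X (b i) = hsymm.eigenvalues rfl i • b i := fun i =>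
    hsymm.apply_eigenvectorBasis rfl i
  have h1 := inner_apply_eq_sum b 1 (fun _ => 1) (fun i => by simp) u
  rw [one_apply_eq_self] at h1
  rw [h1, inner_apply_eq_sum b _ _ hb, inner_apply_eq_sum b (ρ (γ 1)) _ fun i =>
    hγ.rep_apply_eigenvector hρ (hb i), ← Finset.sum_add_distrib]
  refine Finset.sum_le_sum fun i _ => ?_
  rw [← add_mul]
  refine mul_le_mul_of_nonneg_right ?_ (sq_nonneg _)
  rw [add_comm]
  exact Real.add_one_le_exp _

end Exponential

/-- The Killing form is nondegenerate in the presence of a Cartan involution, so it represents every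
linear functional. -/
lemma exists_killingForm_eq {θ : GroupLieAlgebra (𝓡 n) G → GroupLieAlgebra (𝓡 n) G}
    (hθ : IsCartanInvolution θ) (l : GroupLieAlgebra (𝓡 n) G →ₗ[ℝ] ℝ) :
    ∃ W, ∀ Z, killingForm ℝ (GroupLieAlgebra (𝓡 n) G) W Z = l Z := by
  have : FiniteDimensional ℝ (GroupLieAlgebra (𝓡 n) G) :=
    inferInstanceAs (FiniteDimensional ℝ (EuclideanSpace ℝ (Fin n)))
  have hinj : Function.Injective (killingForm ℝ (GroupLieAlgebra (𝓡 n) G)) := by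
    refine (injective_iff_map_eq_zero _).2 fun X hX => ?_
    by_contra hne
    have := hθ.pos X hne
    rw [hX, LinearMap.zero_apply, neg_zero] at this
    exact this.false
  have hsurj := (LinearMap.injective_iff_surjective_of_finrank_eq_finrank
    (Subspace.dual_finrank_eq (K := ℝ) (V := GroupLieAlgebra (𝓡 n) G)).symm).1 hinj
  obtain ⟨W, hW⟩ := hsurj l
  exact ⟨W, fun Z => LinearMap.congr_fun hW Z⟩

variable [T2Space G] {Θ : G →* G}

/-- The elements of the Lie algebra orthogonal to `𝔨` are anti-invariant under the Cartan
involution. -/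
lemma differential_eq_neg_of_mem_killingOrthogonal (hΘ : IsGlobalCartanInvolution n Θ)
    {X : GroupLieAlgebra (𝓡 n) G}
    (hX : X ∈ killingOrthogonal (lieAlgebraOf n (fixedSubgroup Θ))) :
    differential n Θ X = -X := by
  set θ := differential n Θ with hθdef
  have hθ : IsCartanInvolution θ := hΘ.cartan
  have hinv : θ (X + θ X) = X + θ X := by
    rw [hθ.map_add, hθ.involutive, add_comm]
  have hfix := mem_lieAlgebraOf_fixedSubgroup hΘ.smooth hinv
  by_contra hne
  have hne' : X + θ X ≠ 0 := fun h => hne (eq_neg_of_add_eq_zero_right h)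
  have h1 := hθ.pos _ hne'
  have h2 := hX _ hfix
  have h3 := hθ.symm X (X + θ X)
  rw [hinv, h2] at h3
  rw [hinv, map_add, LieModule.traceForm_comm ℝ _ _ _ X, h2] at h1
  linarith

variable {V : Type*} [NormedAddCommGroup V] [InnerProductSpace ℝ V] {ρ : G →* (V →L[ℝ] V)}

/-- If `X` is orthogonal to the Lie algebra of the centraliser of `H`, then `dρ X` is orthogonal to
the commutant of `ρ(H)` for the trace form: for `b` in the commutant, the `H`-invariant functional
`Z ↦ tr (dρ(Z) b)` is represented through the Killing form by an `H`-invariant vector. -/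
lemma opTrace_tangentRep_mul_eq_zero (hΘ : IsGlobalCartanInvolution n Θ)
    (hρ : ContMDiff (𝓡 n) 𝓘(ℝ, V →L[ℝ] V) ∞ ρ) {H : Subgroup G} {X : GroupLieAlgebra (𝓡 n) G}
    (hX : X ∈ killingOrthogonal (lieAlgebraOf n (Subgroup.centralizer (H : Set G))))
    (b : V →L[ℝ] V) (hb : ∀ h : H, ρ h * b = b * ρ h) :
    opTrace V (tangentRep n ρ X * b) = 0 := by
  let l : GroupLieAlgebra (𝓡 n) G →ₗ[ℝ] ℝ :=
    opTrace V ∘ₗ LinearMap.mulRight ℝ b ∘ₗ (tangentRep n ρ : _ →ₗ[ℝ] (V →L[ℝ] V))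
  have hl : ∀ Z, l Z = opTrace V (tangentRep n ρ Z * b) := fun Z => rfl
  obtain ⟨W, hW⟩ := exists_killingForm_eq hΘ.cartan l
  have hinv : ∀ h ∈ H, ∀ Z, l (Ad n h Z) = l Z := by
    intro h hh Z
    have hb' : ρ h⁻¹ * b = b * ρ h⁻¹ := hb ⟨h⁻¹, H.inv_mem hh⟩
    have h1 : ρ h⁻¹ * ρ h = 1 := by rw [← map_mul, inv_mul_cancel, map_one]
    rw [hl, hl, tangentRep_Ad hρ, mul_assoc, hb', opTrace_mul_comm, ← mul_assoc, mul_assoc b,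
      h1, mul_one, opTrace_mul_comm]
  have hfix : ∀ h ∈ H, Ad n h W = W := by
    intro h hh
    have hinj : ∀ Z, killingForm ℝ (GroupLieAlgebra (𝓡 n) G) (Ad n h W) Z =
        killingForm ℝ (GroupLieAlgebra (𝓡 n) G) W Z := fun Z => by
      conv_lhs => rw [← Ad_Ad_inv h Z, killingForm_Ad, hW, hinv _ (H.inv_mem hh), ← hW]
    by_contra hne
    have h1 := hΘ.cartan.pos _ (sub_ne_zero.2 hne)
    rw [map_sub, LinearMap.sub_apply, hinj, sub_self, neg_zero] at h1
    exact h1.false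
  rw [← hl, ← hW, LieModule.traceForm_comm]
  exact hX W (mem_lieAlgebraOf_centralizer hfix)

variable [FiniteDimensional ℝ V]

/-- If `H` is stable under the Cartan involution, then `ρ(H)` is stable under adjunction. -/
lemma isSelfAdjointGroup_rep [ConnectedSpace G] (hρ : ContMDiff (𝓡 n) 𝓘(ℝ, V →L[ℝ] V) ∞ ρ)
    (hΘ : ContMDiff (𝓡 n) (𝓡 n) ∞ Θ) (hV : IsAdapted n Θ ρ) {H : Subgroup G}
    (hΘH : ∀ h ∈ H, Θ h ∈ H) : IsSelfAdjointGroup (ρ.comp H.subtype) := by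
  have := FiniteDimensional.complete ℝ V
  intro h
  refine ⟨⟨(Θ h)⁻¹, H.inv_mem (hΘH h h.2)⟩, fun u w => ?_⟩
  change inner ℝ (ρ h u) w = inner ℝ u (ρ (Θ h)⁻¹ w)
  have h1 : ρ (Θ h)⁻¹ = ContinuousLinearMap.adjoint (ρ h) := by
    calc ρ (Θ h)⁻¹ = ρ (Θ h)⁻¹ * (ρ (Θ h) * ContinuousLinearMap.adjoint (ρ h)) := by
          rw [hV.rep_mul_adjoint hρ hΘ, mul_one]
      _ = ContinuousLinearMap.adjoint (ρ h) := by
          rw [← mul_assoc, ← map_mul, inv_mul_cancel, map_one, one_mul]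
  rw [h1, ContinuousLinearMap.adjoint_inner_right]

end LieGroup

end CartanRep

end

theorem corollary3p5 {n : ℕ} {G : Type*} [TopologicalSpace G] [T2Space G] [ConnectedSpace G]
    [ChartedSpace (EuclideanSpace ℝ (Fin n)) G] [Group G] [LieGroup (𝓡 n) ∞ G]
    [LieAlgebra.IsSemisimple ℝ (GroupLieAlgebra (𝓡 n) G)]
    (H : Subgroup G) (hH : CartanRep.IsReductiveIn n H)
    (Θ : G →* G) (hΘ : CartanRep.IsGlobalCartanInvolution n Θ)
    (hΘH : ∀ h ∈ H, Θ h ∈ H)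
    {V : Type*} [NormedAddCommGroup V] [InnerProductSpace ℝ V] [FiniteDimensional ℝ V]
    (ρ : G →* (V →L[ℝ] V)) (hρ : ContMDiff (𝓡 n) 𝓘(ℝ, V →L[ℝ] V) ∞ ρ)
    (hV : CartanRep.IsAdapted n Θ ρ)
    (Ω : Set H) (hΩ : Ω.Nonempty)
    (hstar : ∀ f ∈ CartanRep.coeffSpace ρ H, (∀ x ∈ Ω, f x = 0) → ∀ h, f h = 0)
    (hdim : 0 < Module.finrank ℝ V) :
    (∃! π : CartanRep.coeffSpace ρ H →ₗ[ℝ] ℝ, CartanRep.IsConstProjector ρ H π) ∧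
    ∀ π : CartanRep.coeffSpace ρ H →ₗ[ℝ] ℝ, CartanRep.IsConstProjector ρ H π →
      1 ≤ CartanRep.cConst ρ H π Ω ∧ CartanRep.cConst ρ H π Ω < ⊤ ∧
      ∀ p ∈ CartanRep.expImage (CartanRep.pSpace n Θ H), ∀ v : V,
        ((‖v‖ : ℝ) : EReal) / CartanRep.cConst ρ H π Ω ≤
          ⨆ x ∈ Ω, ((‖ρ ((x : G)⁻¹ * p * (x : G)) v‖ : ℝ) : EReal) := by
  have hr := CartanRep.isSelfAdjointGroup_rep hρ hΘ.smooth hV hΘH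
  have : Nontrivial V := Module.finrank_pos_iff.1 hdim
  refine ⟨CartanRep.existsUnique_constProjector hr, fun π hπ =>
    ⟨CartanRep.one_le_cConst hπ Ω, CartanRep.cConst_lt_top hstar π, ?_⟩⟩
  rintro _ ⟨X, hX, γ, hγ, rfl⟩ v
  have hθX := CartanRep.differential_eq_neg_of_mem_killingOrthogonal hΘ hX.1
  have h1 := CartanRep.norm_div_cConst_le hr hΩ hstar hπ (ρ (γ 1)) (CartanRep.tangentRep n ρ X)
    (CartanRep.inner_add_inner_tangentRep_le hρ hV hθX hγ)
    (CartanRep.opTrace_tangentRep_mul_eq_zero hΘ hρ hX.2) v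
  simpa only [map_mul] using h1
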